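/- Let $n\ge 2$, $k=n-1$, and $R(T)=\mathbb Z[e^{\pm a_1},\dots,e^{\pm a_n}]/(e^{a_1+\cdots+a_n}-1)$, with indices of the $a_i$ read modulo $n$, and put $b_i=1-e^{-a_i}$. Let $\hat\Lambda$ be the $R(T)$-algebra of symmetric formal power series in $y=(y_1,y_2,\dots)$ over $R(T)$ and $\Omega(b_i|y)=\prod_{j\ge1}(1-b_iy_j)^{-1}$. For $1\le i\le n-1$ let $s_i$ act on $\hat\Lambda$ by exchanging $a_i$ and $a_{i+1}$ in the coefficients, and let $s_0(f)=\frac{\Omega(b_1|y)}{\Omega(b_n|y)}s_\theta(f)$, where $s_\theta$ exchanges $a_1$ and $a_n$. Put $\alpha_i=a_i-a_{i+1}$ for $1\le i\le n-1$, $\alpha_0=a_n-a_1$, $T_i=(1-e^{\alpha_i})^{-1}(s_i-1)$ and $D_i=T_i+1$ $(0\le i\le n-1)$. For $x$ in the affine Weyl group of type $A^{(1)}_{n-1}$ with reduced expression $x=s_{i_1}\cdots s_{i_l}$ put $T_x=T_{i_1}\cdots T_{i_l}$, $D_x=D_{i_1}\cdots D_{i_l}$, $g^{(k)}_x(y|b)=T_x(1)$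 and $\tilde g^{(k)}_x(y|b)=D_x(1)$. For a partition $\lambda$ with $\lambda_1\le k$ put $g^{(k)}_\lambda=g^{(k)}_{x_\lambda}$ and $\tilde g^{(k)}_\lambda=\tilde g^{(k)}_{x_\lambda}$, where $x_\lambda$ is the product of the $s_{j-i \bmod n}$ over the boxes $(i,j)$ of $\lambda$, taken from the bottom row to the top row and from right to left in each row. Let $R_i=(i^{\,n-i})$ for $1\le i\le n$ (so $R_n=\varnothing$), and $\xi_\lambda(y)=\prod_{r=1}^{\ell(\lambda)}\Omega(b_{1-r}|y)$. Let $A$ be the $n\times n$ matrix with diagonal entries $e^{-a_1},\dots,e^{-a_n}$, entries $-1$ just above the diagonal, and $0$ elsewhere; let $P$ be the lower unitriangular matrix with entries $P_{pq}=e_{p-q}(e^{-a_1},\dots,e^{-a_{p-1}})$ for $q\le p$ (elementary symmetric polynomials). Let $\mathscr O(\tilde{\mathscr Z})$ be the $R(T)$-algebra generated by $z_{ii}^{\pm1}$ $(1\le i\le n)$ and $z_{ij}$ $(1\le i<j\le n)$ subject to the relations $AZ=ZA$ for the upper triangular matrix $Z=(z_{ij})$. Let $\tau_m$ and $\sigma_m$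 be the leading principal $m\times m$ minors of $ZAP$ and $ZP$, with $\tau_0=\sigma_0=1$. Then there is a (necessarily unique) homomorphism of $R(T)$-algebras $\beta:\mathscr O(\tilde{\mathscr Z})\to\hat\Lambda$ with $$\beta(z_{ij})=e^{a_i+\cdots+a_{j-1}}\,\Omega(b_i|y)\,g^{(k)}_{\rho_{j-i}}(y|\omega^i b)\qquad(1\le i\le j\le n),$$ where $\rho_l=s_{l-1}\cdots s_1s_0$ and $f(y|\omega^ib)$ is obtained from $f(y|b)$ by $a_j\mapsto a_{j+i}$ in the coefficients; and, for $1\le i\le n$, $$\tilde g^{(k)}_{R_i}(y|b)=\frac{\beta(\sigma_{n-i})}{\xi_{R_i}(y)},\qquad g^{(k)}_{R_i}(y|b)=e^{\sum_{s=0}^{n-i-1}a_{i-s}}\,\frac{\beta(\tau_{n-i})}{\xi_{R_i}(y)} .$$ -/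

import Mathlib

open scoped BigOperators

namespace KkSchur

noncomputable section

/-! ### The representation ring of the maximal torus of `SL_n`

Indices `1, …, n` are read in `ZMod n`, so that the index `n` is the class of `0`. -/

/-- The weight lattice `⊕ ℤ a_i / ℤ (a_1 + ⋯ + a_n)` of the maximal torus of `SL_n`. -/
abbrev Weight (n : ℕ) : Type :=
  (ZMod n → ℤ) ⧸ AddSubgroup.zmultiples (1 : ZMod n → ℤ)

/-- `R(T) = ℤ[e^{± a_1}, …, e^{± a_n}] / (e^{a_1 + ⋯ + a_n} - 1)`, the group ring of the weight
lattice. -/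
def RT (n : ℕ) : Type := AddMonoidAlgebra ℤ (Weight n)

instance (n : ℕ) : CommRing (RT n) := inferInstanceAs (CommRing (AddMonoidAlgebra ℤ (Weight n)))

variable {n : ℕ}

/-- The weight `a_i`; thus `a_0 = a_n`. -/
def wt (i : ZMod n) : Weight n := QuotientAddGroup.mk (Pi.single i 1)

/-- The element `e^μ` of `R(T)`. -/
def ex (μ : Weight n) : RT n := (AddMonoidAlgebra.single μ 1 : AddMonoidAlgebra ℤ (Weight n))

theorem ex_add (μ ν : Weight n) : ex (μ + ν) = ex μ * ex ν := by
  have h : (AddMonoidAlgebra.single μ 1 * AddMonoidAlgebra.single ν 1 :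
      AddMonoidAlgebra ℤ (Weight n)) = AddMonoidAlgebra.single (μ + ν) 1 := by
    rw [AddMonoidAlgebra.single_mul_single, one_mul]
  exact h.symm

theorem ex_zero : ex (0 : Weight n) = 1 := rfl

/-- `b_i = 1 - e^{-a_i}`. -/
def bpar (i : ZMod n) : RT n := 1 - ex (-wt i)

/-- The simple roots: `α_i = a_i - a_{i+1}` for `i ≠ 0`, and `α_0 = a_n - a_1 = -θ`. -/
def simpleRoot (i : ZMod n) : Weight n := wt i - wt (i + 1)

/-- The action of a permutation of the indices on weights, `a_j ↦ a_{w(j)}`. -/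
def permWeight (w : Equiv.Perm (ZMod n)) : Weight n →+ Weight n :=
  QuotientAddGroup.map _ _ (LinearMap.funLeft ℤ ℤ w.symm).toAddMonoidHom (by
    rw [AddSubgroup.zmultiples_le, AddSubgroup.mem_comap]
    exact AddSubgroup.mem_zmultiples (1 : ZMod n → ℤ))

theorem permWeight_wt (w : Equiv.Perm (ZMod n)) (j : ZMod n) :
    permWeight w (wt j) = wt (w j) := by
  have : (LinearMap.funLeft ℤ ℤ w.symm) (Pi.single j (1 : ℤ)) = Pi.single (w j) 1 := by
    ext t
    simp [LinearMap.funLeft_apply, Pi.single_apply, Equiv.symm_apply_eq]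
  simp only [permWeight, wt, QuotientAddGroup.map_mk]
  exact congrArg _ this

/-- The action of a permutation of the indices on `R(T)`, `e^{a_j} ↦ e^{a_{w(j)}}`. -/
def permRT (w : Equiv.Perm (ZMod n)) : RT n →+* RT n :=
  (AddMonoidAlgebra.mapDomainRingHom ℤ (permWeight w) :
    AddMonoidAlgebra ℤ (Weight n) →+* AddMonoidAlgebra ℤ (Weight n))

theorem permRT_ex (w : Equiv.Perm (ZMod n)) (μ : Weight n) :
    permRT w (ex μ) = ex (permWeight w μ) := by
  change AddMonoidAlgebra.mapDomainRingHom ℤ (permWeight w) (AddMonoidAlgebra.single μ 1) =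
    AddMonoidAlgebra.single (permWeight w μ) 1
  simp

theorem weight_torsionFree (n : ℕ) : IsAddTorsionFree (Weight n) := by
  refine ⟨fun k hk μ ν h => ?_⟩
  obtain ⟨u, rfl⟩ := QuotientAddGroup.mk_surjective μ
  obtain ⟨v, rfl⟩ := QuotientAddGroup.mk_surjective ν
  change (QuotientAddGroup.mk (k • u) : Weight n) = QuotientAddGroup.mk (k • v) at h
  rw [QuotientAddGroup.eq, AddSubgroup.mem_zmultiples_iff] at h ⊢
  obtain ⟨c, hc⟩ := h
  have hc' : ∀ t, c = k * (v t - u t) := by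
    intro t
    have := congrFun hc t
    simp at this
    linarith
  refine ⟨v 0 - u 0, ?_⟩
  ext t
  have hk' : (k : ℤ) ≠ 0 := by exact_mod_cast hk
  have := mul_left_cancel₀ hk' ((hc' 0).symm.trans (hc' t))
  simp
  linarith

instance [NeZero n] : NoZeroDivisors (RT n) := by
  have := weight_torsionFree n
  exact inferInstanceAs (NoZeroDivisors (AddMonoidAlgebra ℤ (Weight n)))

theorem one_sub_ex_simpleRoot_ne_zero [NeZero n] (hn : 2 ≤ n) (i : ZMod n) :
    1 - ex (simpleRoot i) ≠ 0 := by
  intro h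
  have h1 : (AddMonoidAlgebra.single (simpleRoot i) 1 : AddMonoidAlgebra ℤ (Weight n)) =
      AddMonoidAlgebra.single 0 1 := (sub_eq_zero.1 h).symm
  have h2 : simpleRoot i = 0 := AddMonoidAlgebra.single_left_injective one_ne_zero h1
  have : Fact (1 < n) := ⟨hn⟩
  have hne : i + 1 ≠ i := by simp
  have h3 : (QuotientAddGroup.mk (Pi.single i 1 : ZMod n → ℤ) : Weight n) =
    QuotientAddGroup.mk (Pi.single (i + 1) 1) := sub_eq_zero.1 h2
  rw [QuotientAddGroup.eq, AddSubgroup.mem_zmultiples_iff] at h3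
  obtain ⟨c, hc⟩ := h3
  have e1 := congrFun hc i
  have e2 := congrFun hc (i + 1)
  simp [hne, hne.symm] at e1 e2
  omega

/-! ### Symmetric formal power series -/

/-- The `R(T)`-algebra `Λ̂` of symmetric formal power series in `y_1, y_2, …` over `R(T)`. -/
def LambdaHat (n : ℕ) : Subalgebra (RT n) (MvPowerSeries ℕ (RT n)) where
  carrier := {f | ∀ π : Equiv.Perm ℕ, MvPowerSeries.renameEquiv (RT n) π f = f}
  mul_mem' hf hg π := by rw [map_mul, hf π, hg π]
  add_mem' hf hg π := by rw [map_add, hf π, hg π]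
  algebraMap_mem' r π := by rw [AlgEquiv.commutes]

/-- The action of a permutation of the indices on the coefficients of a symmetric power series. -/
def permLambda (w : Equiv.Perm (ZMod n)) (f : LambdaHat n) : LambdaHat n :=
  ⟨MvPowerSeries.map (permRT w) f.1, fun π => by
    have h : MvPowerSeries.rename π f.1 = f.1 := f.2 π
    change MvPowerSeries.rename π (MvPowerSeries.map (permRT w) f.1) = _
    rw [MvPowerSeries.rename_map, h]⟩

theorem coeff_renameEquiv {R : Type*} [CommRing R] (π : Equiv.Perm ℕ) (f : MvPowerSeries ℕ R)
    (m : ℕ →₀ ℕ) :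
    MvPowerSeries.coeff m (MvPowerSeries.renameEquiv R π f) =
      MvPowerSeries.coeff (m.mapDomain π.symm) f := by
  have h := MvPowerSeries.coeff_embDomain_rename π.toEmbedding f (m.mapDomain π.symm)
  rw [← h, Finsupp.embDomain_eq_mapDomain, ← Finsupp.mapDomain_comp]
  simp

/-- The power series `∏_j (1 - c y_j)⁻¹ = ∏_j (1 + c y_j + c² y_j² + ⋯)`: the coefficient of a
monomial of degree `d` is `c ^ d`. -/
def omegaSeries (c : RT n) : MvPowerSeries ℕ (RT n) := fun m => c ^ m.degree

theorem omegaSeries_mem (c : RT n) : omegaSeries c ∈ LambdaHat n := by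
  intro π
  ext1 m
  rw [coeff_renameEquiv]
  change c ^ (m.mapDomain π.symm).degree = c ^ m.degree
  congr 1
  exact Finsupp.degree_mapDomain _ _

theorem isUnit_omegaSeries (c : RT n) :
    IsUnit (⟨omegaSeries c, omegaSeries_mem c⟩ : LambdaHat n) := by
  have h0 : IsUnit (omegaSeries c) := by
    rw [MvPowerSeries.isUnit_iff_constantCoeff, ← MvPowerSeries.coeff_zero_eq_constantCoeff_apply]
    change IsUnit (c ^ (0 : ℕ →₀ ℕ).degree)
    simp
  obtain ⟨u, hu⟩ := h0
  have hmem : (↑u⁻¹ : MvPowerSeries ℕ (RT n)) ∈ LambdaHat n := by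
    intro π
    have h1 : MvPowerSeries.renameEquiv (RT n) π (u : MvPowerSeries ℕ (RT n)) = u := by
      rw [hu]; exact omegaSeries_mem c π
    have h2 := congrArg (MvPowerSeries.renameEquiv (RT n) π) u.mul_inv
    rw [map_mul, h1, map_one] at h2
    rw [← one_mul (MvPowerSeries.renameEquiv (RT n) π _), ← u.inv_mul, mul_assoc, h2, mul_one]
  refine IsUnit.of_mul_eq_one (⟨↑u⁻¹, hmem⟩ : LambdaHat n) ?_
  apply Subtype.ext
  change omegaSeries c * ↑u⁻¹ = 1
  rw [← hu, u.mul_inv]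

/-- `Ω(c|y) = ∏_j (1 - c y_j)⁻¹`, as an invertible element of `Λ̂`. -/
def Omega (c : RT n) : (LambdaHat n)ˣ := (isUnit_omegaSeries c).unit

/-! ### Demazure operators -/

/-- The action of the simple reflections on `Λ̂`: for `i ≠ 0`, `s_i` exchanges `a_i` and
`a_{i+1}`, and `s_0 f = Ω(b_1|y) Ω(b_n|y)⁻¹ s_θ(f)`, with `s_θ` exchanging `a_n` and `a_1`. -/
def simpleRefl (i : ZMod n) (f : LambdaHat n) : LambdaHat n :=
  if i = 0 then
    ((Omega (bpar (1 : ZMod n)) * (Omega (bpar (0 : ZMod n)))⁻¹ : (LambdaHat n)ˣ) : LambdaHat n) *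
      permLambda (Equiv.swap 0 1) f
  else permLambda (Equiv.swap i (i + 1)) f

theorem hom_permRT [NeZero n] {Q : Type*} [CommRing Q] (q : RT n →+* Q) (i : ZMod n)
    (hα : q (ex (simpleRoot i)) = 1) (r : RT n) :
    q (permRT (Equiv.swap i (i + 1)) r) = q r := by
  have hi : q (ex (wt i)) = q (ex (wt (i + 1))) := by
    have : wt i = simpleRoot i + wt (i + 1) := by simp [simpleRoot]
    rw [this, ex_add, map_mul, hα, one_mul]
  let S : AddSubgroup (Weight n) :=
    { carrier := {μ | q (ex (permWeight (Equiv.swap i (i + 1)) μ)) = q (ex μ)}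
      zero_mem' := by simp
      add_mem' := by
        intro μ ν hμ hν
        change q _ = q _ at hμ hν
        change q _ = q _
        rw [map_add, ex_add, ex_add, map_mul, map_mul, hμ, hν]
      neg_mem' := by
        intro μ hμ
        change q _ = q _ at hμ
        change q _ = q _
        rw [map_neg]
        have h1 : q (ex (permWeight (Equiv.swap i (i + 1)) μ)) *
            q (ex (-permWeight (Equiv.swap i (i + 1)) μ)) = 1 := by
          rw [← map_mul, ← ex_add, add_neg_cancel, ex_zero, map_one]
        have h2 : q (ex (-μ)) * q (ex μ) = 1 := by
          rw [← map_mul, ← ex_add, neg_add_cancel, ex_zero, map_one]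
        rw [hμ] at h1
        calc _ = (q (ex (-μ)) * q (ex μ)) * q (ex (-permWeight (Equiv.swap i (i + 1)) μ)) := by
              rw [h2, one_mul]
          _ = q (ex (-μ)) := by rw [mul_assoc, h1, mul_one] }
  have hwt : ∀ j, wt j ∈ S := by
    intro j
    change q (ex (permWeight _ (wt j))) = q (ex (wt j))
    rw [permWeight_wt, Equiv.swap_apply_def]
    split_ifs with h1 h2
    · rw [h1, hi]
    · rw [h2, hi]
    · rfl
  have hS : ∀ μ, μ ∈ S := by
    intro μ
    obtain ⟨v, rfl⟩ := QuotientAddGroup.mk_surjective μ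
    have hv : (QuotientAddGroup.mk v : Weight n) = ∑ j, v j • wt j := by
      have h : v = ∑ j, v j • Pi.single j (1 : ℤ) := by
        ext t
        simp [Finset.sum_apply, Pi.single_apply]
      conv_lhs => rw [h]
      change QuotientAddGroup.mk' _ (∑ j, v j • Pi.single j (1 : ℤ)) = _
      rw [map_sum]
      rfl
    rw [hv]
    exact sum_mem fun j _ => zsmul_mem (hwt j) _
  have hcomp : q.comp (permRT (Equiv.swap i (i + 1))) = q := by
    refine AddMonoidAlgebra.ringHom_ext (R := ℤ) (M := Weight n) ?_ ?_
    · intro z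
      have hz : (AddMonoidAlgebra.single 0 z : AddMonoidAlgebra ℤ (Weight n)) = ((z : RT n)) :=
        (AddMonoidAlgebra.intCast_def z).symm
      have h : q (permRT (Equiv.swap i (i + 1)) (z : RT n)) = q (z : RT n) := by
        rw [map_intCast, map_intCast]
      rw [← hz] at h
      exact h
    · intro μ
      have h := hS μ
      change q (permRT _ (ex μ)) = q (ex μ)
      rw [permRT_ex]
      exact h
  exact congrArg (fun φ : RT n →+* Q => φ r) hcomp

theorem hom_coeff_simpleRefl [NeZero n] {Q : Type*} [CommRing Q] (q : RT n →+* Q) (i : ZMod n)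
    (hα : q (ex (simpleRoot i)) = 1) (f : LambdaHat n) (m : ℕ →₀ ℕ) :
    q (MvPowerSeries.coeff m (simpleRefl i f).1) = q (MvPowerSeries.coeff m f.1) := by
  by_cases h0 : i = 0
  · subst h0
    let φ : LambdaHat n →+* MvPowerSeries ℕ Q :=
      (MvPowerSeries.map q).comp (LambdaHat n).val.toRingHom
    have hb : q (bpar (1 : ZMod n)) = q (bpar 0) := by
      have : -wt (1 : ZMod n) = -wt 0 + simpleRoot 0 := by
        rw [simpleRoot, zero_add]; abel
      rw [bpar, bpar, this, ex_add, map_sub, map_sub, map_mul, hα, mul_one]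
    have hΩ : φ (Omega (bpar (1 : ZMod n)) : LambdaHat n) =
        φ (Omega (bpar (0 : ZMod n)) : LambdaHat n) := by
      ext1 k
      change q (bpar (1 : ZMod n) ^ k.degree) = q (bpar (0 : ZMod n) ^ k.degree)
      rw [map_pow, map_pow, hb]
    have hu : φ ((Omega (bpar (1 : ZMod n)) * (Omega (bpar (0 : ZMod n)))⁻¹ :
        (LambdaHat n)ˣ) : LambdaHat n) = 1 := by
      rw [Units.val_mul, map_mul, hΩ, ← map_mul, Units.mul_inv, map_one]
    have hp : φ (permLambda (Equiv.swap 0 1) f) = φ f := by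
      ext1 k
      have := hom_permRT q 0 hα (MvPowerSeries.coeff k f.1)
      rwa [zero_add] at this
    have hfin : φ (simpleRefl 0 f) = φ f := by
      rw [simpleRefl, if_pos rfl, map_mul, hu, hp, one_mul]
    exact congrArg (MvPowerSeries.coeff m) hfin
  · rw [simpleRefl, if_neg h0]
    exact hom_permRT q i hα (MvPowerSeries.coeff m f.1)

/-- `s_i f - f` is divisible by `1 - e^{α_i}` in `Λ̂`. -/
theorem exists_demazure [NeZero n] (i : ZMod n) (f : LambdaHat n) :
    ∃ g : LambdaHat n, (1 - ex (simpleRoot i)) • g = simpleRefl i f - f := by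
  have key : ∀ m, (1 - ex (simpleRoot i)) ∣
      MvPowerSeries.coeff m (simpleRefl i f - f : LambdaHat n).1 := by
    intro m
    rw [← Ideal.mem_span_singleton]
    have h := hom_coeff_simpleRefl (Ideal.Quotient.mk (Ideal.span {1 - ex (simpleRoot i)})) i
      ((Ideal.Quotient.eq.2 (Ideal.mem_span_singleton_self _)).symm) f m
    exact Ideal.Quotient.eq.1 h
  classical
  let δ : RT n → RT n := fun c => if h : (1 - ex (simpleRoot i)) ∣ c then h.choose else 0
  have hδ : ∀ c, (1 - ex (simpleRoot i)) ∣ c → (1 - ex (simpleRoot i)) * δ c = c := by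
    intro c hc
    simp only [δ, dif_pos hc]
    exact hc.choose_spec.symm
  refine ⟨⟨fun m => δ (MvPowerSeries.coeff m (simpleRefl i f - f : LambdaHat n).1), ?_⟩, ?_⟩
  · intro π
    ext1 m
    refine (coeff_renameEquiv π _ m).trans ?_
    change δ (MvPowerSeries.coeff _ _) = δ (MvPowerSeries.coeff _ _)
    rw [← coeff_renameEquiv, (simpleRefl i f - f : LambdaHat n).2 π]
  · apply Subtype.ext
    ext1 m
    exact hδ _ (key m)

/-- The quotient of `s_i f - f` by `1 - e^{α_i}` is unique. -/
theorem demazure_unique [NeZero n] (hn : 2 ≤ n) (i : ZMod n) {g h : LambdaHat n}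
    (hgh : (1 - ex (simpleRoot i)) • g = (1 - ex (simpleRoot i)) • h) : g = h := by
  apply Subtype.ext
  ext1 m
  have := congrArg (fun f : LambdaHat n => MvPowerSeries.coeff m f.1) hgh
  exact mul_left_cancel₀ (one_sub_ex_simpleRoot_ne_zero hn i) this

/-- The Demazure operator `T_i = (1 - e^{α_i})⁻¹ (s_i - 1)` on `Λ̂`. -/
def demazureT [NeZero n] (i : ZMod n) (f : LambdaHat n) : LambdaHat n :=
  (exists_demazure i f).choose

theorem demazureT_spec [NeZero n] (i : ZMod n) (f : LambdaHat n) :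
    (1 - ex (simpleRoot i)) • demazureT i f = simpleRefl i f - f :=
  (exists_demazure i f).choose_spec

/-- The Demazure operator `D_i = T_i + 1` on `Λ̂`. -/
def demazureD [NeZero n] (i : ZMod n) (f : LambdaHat n) : LambdaHat n := demazureT i f + f

/-! ### The affine Weyl group and the `K`-theoretic double `k`-Schur functions, `k = n - 1` -/

/-- The Coxeter matrix of type `A_{n-1}^{(1)}`, with nodes `ℤ/n`: a cycle for `n ≥ 3`; for `n = 2`
the two generators satisfy no braid relation, which is encoded by the entry `0`. -/
def affineA (n : ℕ) : CoxeterMatrix (ZMod n) where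
  M := Matrix.of fun i j =>
    if i = j then 1 else if n = 2 then 0 else if j = i + 1 ∨ i = j + 1 then 3 else 2
  isSymm := by
    ext i j
    simp only [Matrix.transpose_apply, Matrix.of_apply, eq_comm (a := j) (b := i),
      or_comm (a := i = j + 1)]
  diagonal i := by simp
  off_diagonal i j h := by
    simp only [Matrix.of_apply, if_neg h]
    split_ifs <;> decide

/-- The affine Weyl group of `SL_n`, with generators `s_0, …, s_{n-1}`. -/
abbrev AffineWeyl (n : ℕ) : Type := (affineA n).Group

/-- The affine Weyl group as a Coxeter system. -/
abbrev affineSystem (n : ℕ) : CoxeterSystem (affineA n) (AffineWeyl n) :=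
  (affineA n).toCoxeterSystem

/-- A reduced word `[i_1, …, i_l]` of `x = s_{i_1} ⋯ s_{i_l}`. Since the Demazure operators satisfy
the braid relations, the operators `T_x` and `D_x` do not depend on which one is taken. -/
def reducedWord (x : AffineWeyl n) : List (ZMod n) := ((affineSystem n).exists_isReduced x).choose

/-- `T_x = T_{i_1} ⋯ T_{i_l}` for a reduced expression `x = s_{i_1} ⋯ s_{i_l}`. -/
def opT [NeZero n] (x : AffineWeyl n) (f : LambdaHat n) : LambdaHat n :=
  (reducedWord x).foldr demazureT f

/-- `D_x = D_{i_1} ⋯ D_{i_l}` for a reduced expression `x = s_{i_1} ⋯ s_{i_l}`. -/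
def opD [NeZero n] (x : AffineWeyl n) (f : LambdaHat n) : LambdaHat n :=
  (reducedWord x).foldr demazureD f

/-- The `K`-theoretic double `k`-Schur function `g_x^{(k)}(y|b) = T_x(1)`. -/
def kSchur [NeZero n] (x : AffineWeyl n) : LambdaHat n := opT x 1

/-- The closed `K`-theoretic double `k`-Schur function `g̃_x^{(k)}(y|b) = D_x(1)`. -/
def kSchurClosed [NeZero n] (x : AffineWeyl n) : LambdaHat n := opD x 1

/-- The `n`-residue `c - r` of the box in row `r` and column `c`. -/
def res (n : ℕ) (r c : ℕ) : ZMod n := (c : ZMod n) - (r : ZMod n)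

/-- The residues of the boxes of `lam`, read row by row from the bottom row to the top row, and
from right to left in each row. -/
def residueWord (n : ℕ) (lam : YoungDiagram) : List (ZMod n) :=
  (List.range (lam.colLen 0)).reverse.flatMap fun r =>
    (List.range (lam.rowLen r)).reverse.map fun c => res n r c

/-- The affine Grassmannian element `x_lam` attached to a `k`-bounded partition `lam`: the product
of the generators `s_i` along the residues of `lam`. -/
def partElt (n : ℕ) (lam : YoungDiagram) : AffineWeyl n :=
  (affineSystem n).wordProd (residueWord n lam)

/-- `g_lam^{(k)}(y|b)`. -/
def kSchurPart [NeZero n] (lam : YoungDiagram) : LambdaHat n := kSchur (partElt n lam)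

/-- `g̃_lam^{(k)}(y|b)`. -/
def kSchurClosedPart [NeZero n] (lam : YoungDiagram) : LambdaHat n :=
  kSchurClosed (partElt n lam)

/-- The `k`-rectangle `R_i = (i^{n-i})`. -/
def kRect (n i : ℕ) : YoungDiagram :=
  YoungDiagram.ofRowLens (List.replicate (n - i) i)
    (List.Pairwise.sortedGE (List.pairwise_replicate.2 (Or.inr le_rfl)))

/-- `ξ_lam(y)`, the product of the `Ω(b_res|y)` over the residues of the first column of `lam`. -/
def xi (lam : YoungDiagram) : (LambdaHat n)ˣ :=
  ∏ r ∈ Finset.range (lam.colLen 0), Omega (bpar (res n r 0))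

/-- `ρ_l = s_{l-1} ⋯ s_1 s_0`. -/
def rho (n l : ℕ) : AffineWeyl n :=
  (affineSystem n).wordProd ((List.range l).reverse.map fun t => (t : ZMod n))

/-! ### The centralizer family and the tau-functions

Matrix rows and columns `1, …, n` are indexed by `Fin n`, the element `i : Fin n` standing for
`i + 1`. -/

/-- The element `e^{-a_m}` of `R(T)`. -/
def exNeg (n m : ℕ) : RT n := ex (-wt (m : ZMod n))

/-- The upper bidiagonal matrix `A`, with diagonal `e^{-a_1}, …, e^{-a_n}` and superdiagonal
`-1`. -/
def matA (n : ℕ) : Matrix (Fin n) (Fin n) (RT n) := Matrix.of fun i j =>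
  if j = i then exNeg n ((i : ℕ) + 1) else if (j : ℕ) = (i : ℕ) + 1 then -1 else 0

/-- The elementary symmetric polynomial `e_d(e^{-a_1}, …, e^{-a_m})`. -/
def elemSymm (n m d : ℕ) : RT n := ((Multiset.range m).map fun s => exNeg n (s + 1)).esymm d

/-- The lower unitriangular matrix `P`: its entry in row `p` and column `q ≤ p` (counted from `1`)
is `e_{p-q}(e^{-a_1}, …, e^{-a_{p-1}})`. -/
def matP (n : ℕ) : Matrix (Fin n) (Fin n) (RT n) := Matrix.of fun i j =>
  if j ≤ i then elemSymm n (i : ℕ) ((i : ℕ) - (j : ℕ)) else 0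

/-- The generators `z_{ij}` (`i ≤ j`) and `z_{ii}⁻¹` of `𝒪(𝒵̃)`. -/
abbrev ZGen (n : ℕ) : Type := {p : Fin n × Fin n // p.1 ≤ p.2} ⊕ Fin n

/-- The upper triangular matrix of indeterminates. -/
def freeZ (n : ℕ) : Matrix (Fin n) (Fin n) (MvPolynomial (ZGen n) (RT n)) := Matrix.of fun i j =>
  if h : i ≤ j then MvPolynomial.X (Sum.inl ⟨(i, j), h⟩) else 0

/-- The commutator `A Z - Z A` for the matrix of indeterminates. -/
def commZ (n : ℕ) : Matrix (Fin n) (Fin n) (MvPolynomial (ZGen n) (RT n)) :=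
  (matA n).map MvPolynomial.C * freeZ n - freeZ n * (matA n).map MvPolynomial.C

/-- The ideal generated by the entries of `A Z - Z A` and by the `z_{ii} z_{ii}⁻¹ - 1`. -/
def relZ (n : ℕ) : Ideal (MvPolynomial (ZGen n) (RT n)) :=
  Ideal.span
    (Set.range (fun p : Fin n × Fin n => commZ n p.1 p.2) ∪
      Set.range fun i : Fin n => freeZ n i i * MvPolynomial.X (Sum.inr i) - 1)

/-- The coordinate ring `𝒪(𝒵̃)` of the family of invertible upper triangular matrices `Z` commuting
with `A`. -/
def OZ (n : ℕ) : Type := MvPolynomial (ZGen n) (RT n) ⧸ relZ n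

instance (n : ℕ) : CommRing (OZ n) := inferInstanceAs (CommRing (_ ⧸ relZ n))

instance (n : ℕ) : Algebra (RT n) (OZ n) := inferInstanceAs (Algebra (RT n) (_ ⧸ relZ n))

/-- The matrix `Z = (z_{ij})` of coordinate functions. -/
def matZ (n : ℕ) : Matrix (Fin n) (Fin n) (OZ n) := (freeZ n).map (Ideal.Quotient.mk (relZ n))

/-- The upper left `m × m` minor of an `n × n` matrix. -/
def leadingMinor {R : Type*} [CommRing R] (X : Matrix (Fin n) (Fin n) R) (m : ℕ) (hm : m ≤ n) : R :=
  (X.submatrix (Fin.castLE hm) (Fin.castLE hm)).det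

/-- `τ_m`, the `m`-th leading principal minor of `Z A P`. -/
def tauFun (m : ℕ) (hm : m ≤ n) : OZ n :=
  leadingMinor (matZ n * (matA n).map (algebraMap (RT n) (OZ n)) *
    (matP n).map (algebraMap (RT n) (OZ n))) m hm

/-- `σ_m`, the `m`-th leading principal minor of `Z P`. -/
def sigmaFun (m : ℕ) (hm : m ≤ n) : OZ n :=
  leadingMinor (matZ n * (matP n).map (algebraMap (RT n) (OZ n))) m hm

/-- `f(y|ω^i b)`: the substitution `a_j ↦ a_{j+i}` in the coefficients of `f(y|b)`. -/
def shiftPar (i : ZMod n) (f : LambdaHat n) : LambdaHat n := permLambda (Equiv.addRight i) f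

/-- `e^{a_i + ⋯ + a_{j-1}} Ω(b_i|y) g_{ρ_{j-i}}(y|ω^i b)`, the value on `z_{ij}` of the
homomorphism `𝒪(𝒵̃) → Λ̂`, where `1 ≤ i ≤ j ≤ n`. -/
def zImage [NeZero n] (i j : ℕ) : LambdaHat n :=
  ex (∑ t ∈ Finset.Ico i j, wt (t : ZMod n)) •
    ((Omega (bpar (i : ZMod n)) : LambdaHat n) * shiftPar (i : ZMod n) (kSchur (rho n (j - i))))

end

end KkSchur

/-!
The Demazure operators satisfy the braid relations, because each of `D_i D_{i+1} D_i` and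
`D_{i+1} D_i D_{i+1}` is an antisymmetrization over a copy of `S_3` divided by a Vandermonde
determinant. By Matsumoto's theorem `g_{R_i}` and `g̃_{R_i}` may therefore be computed along the
word formed by the residues of the rectangle, which is reduced since an affine permutation with many
inversions between two blocks has large length.

Multiplication by `ξ_{R_i} = Ω(b_0|y) Ω(b_{-1}|y) ⋯` turns the operators occurring in this word into
ordinary isobaric divided differences. The `0`-Hecke relations make the result invariant under all
permutations of the `a_j`, so that it can be recovered by antisymmetrizing its product with a
monomial: `ξ_{R_i} g̃_{R_i}` is an alternant with `Ω(b_j|y)` in `n - i` of its columns, divided by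
the Vandermonde determinant in the `x_j = e^{-a_j}`. For `g_{R_i}` the relation
`x_{j+1} T_j = D_j x_j` replaces `Ω(b_j|y)` by `Ω(b_j|y) x_j`.

The homomorphism `β` sends `Z` to `Ω(1 - A|y)`: the entries of this matrix and the prescribed values
of `β(z_{ij})` satisfy the same divided difference recursion in `j`. The values of the Newton
polynomials `∏_{s ≤ k} (x_s - t)` at `t = x_j` form an eigenvector of `A`, hence of `Ω(1 - A|y)`
with eigenvalue `Ω(b_j|y)`, and `P` expands the Newton polynomials in powers of `-t`. Consequently
the leading minors of `Ω(1 - A|y) P` and `Ω(1 - A|y) A P` are the same ratios of alternants.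
-/

namespace KkSchur

open CoxeterSystem

section Coxeter

variable {B W G : Type*} [Group W] [Monoid G] {M : CoxeterMatrix B} (cs : CoxeterSystem M W)

theorem prod_map_alternatingWord_two_mul (f : B → G) (i j : B) (k : ℕ) :
    ((alternatingWord i j (2 * k)).map f).prod = (f i * f j) ^ k := by
  induction k with
  | zero => simp [alternatingWord]
  | succ k ih =>
    rw [show 2 * (k + 1) = 2 * k + 1 + 1 by ring, alternatingWord_succ', alternatingWord_succ']
    simp [ih, pow_succ', mul_assoc]

theorem reverse_alternatingWord_two_mul (i j : B) (k : ℕ) :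
    (alternatingWord i j (2 * k)).reverse = alternatingWord j i (2 * k) := by
  induction k with
  | zero => simp [alternatingWord]
  | succ k ih =>
    rw [show 2 * (k + 1) = 2 * k + 1 + 1 by ring, alternatingWord_succ', alternatingWord_succ',
      alternatingWord_succ j, alternatingWord_succ i]
    simp [ih]

theorem wordProd_alternatingWord_two_mul_order_add (i j : B) (k : ℕ) :
    cs.wordProd (alternatingWord i j (2 * (k + M i j) + 1)) =
      cs.wordProd (alternatingWord i j (2 * k + 1)) := by
  simp only [prod_alternatingWord_eq_mul_pow, Nat.not_even_two_mul_add_one, if_false]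
  rw [show (2 * (k + M i j) + 1) / 2 = k + M i j by omega, show (2 * k + 1) / 2 = k by omega,
    pow_add, simple_mul_simple_pow, mul_one]

open scoped Classical in
/-- The involution `(t, ε) ↦ (s_i t s_i, ε + [t = s_i])` of `W × ℤ/2`. These involutions satisfy the
Coxeter relations; the second coordinate of the resulting action counts inversions modulo `2`. -/
noncomputable def parityPerm (i : B) : Equiv.Perm (W × ZMod 2) :=
  Function.Involutive.toPerm
    (fun p => (cs.simple i * p.1 * cs.simple i, p.2 + if p.1 = cs.simple i then 1 else 0)) (by
      rintro ⟨t, ε⟩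
      have h : cs.simple i * t * cs.simple i = cs.simple i ↔ t = cs.simple i := by
        rw [mul_eq_right, mul_eq_one_iff_inv_eq, inv_simple, eq_comm]
      ext
      · simp [mul_assoc]
      · simp only [h, add_assoc, CharTwo.add_self_eq_zero, add_zero])

open scoped Classical in
theorem parityPerm_apply (i : B) (t : W) (ε : ZMod 2) :
    parityPerm cs i (t, ε) =
      (cs.simple i * t * cs.simple i, ε + if t = cs.simple i then 1 else 0) := rfl

open scoped Classical in
theorem prod_map_parityPerm_reverse_apply (ω : List B) (t : W) (ε : ZMod 2) :
    (ω.reverse.map (parityPerm cs)).prod (t, ε) =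
      ((cs.wordProd ω)⁻¹ * t * cs.wordProd ω, ε + ((cs.leftInvSeq ω).count t : ZMod 2)) := by
  induction ω generalizing t ε with
  | nil => simp
  | cons i ω ih =>
    have hconj : t = MulAut.conj (cs.simple i) (cs.simple i * t * cs.simple i) := by
      simp [mul_assoc]
    have hcount : ((cs.leftInvSeq ω).map (MulAut.conj (cs.simple i))).count t =
        (cs.leftInvSeq ω).count (cs.simple i * t * cs.simple i) := by
      conv_lhs => rw [hconj]
      exact List.count_map_of_injective _ _ (MulAut.conj (cs.simple i)).injective _
    simp only [List.reverse_cons, List.map_append, List.prod_append, List.map_singleton,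
      List.prod_singleton, Equiv.Perm.mul_apply, parityPerm_apply, ih, leftInvSeq, wordProd_cons,
      List.count_cons, hcount, beq_iff_eq, eq_comm (a := cs.simple i)]
    ext
    · simp [mul_assoc]
    · push_cast
      ring

open scoped Classical in
theorem count_leftInvSeq_alternatingWord (i j : B) (t : W) :
    ((cs.leftInvSeq (alternatingWord i j (2 * M i j))).count t : ZMod 2) = 0 := by
  set L := cs.leftInvSeq (alternatingWord i j (2 * M i j)) with hL
  have hlen : L.length = 2 * M i j := by simp [hL]
  have hperiod : L.drop (M i j) = L.take (M i j) := by
    refine List.ext_getElem (by simp [hlen]; omega) fun k h₁ h₂ => ?_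
    have hk : k < M i j := by simp at h₂; omega
    simp only [List.getElem_drop, List.getElem_take, hL]
    rw [getElem_leftInvSeq_alternatingWord _ _ _ _ _ (by omega),
      getElem_leftInvSeq_alternatingWord _ _ _ _ _ (by omega), add_comm (M i j) k,
      M.symmetric i j, wordProd_alternatingWord_two_mul_order_add]
  rw [← List.take_append_drop (M i j) L, List.count_append, hperiod, Nat.cast_add,
    CharTwo.add_self_eq_zero]

theorem isLiftable_parityPerm : M.IsLiftable (parityPerm cs) := by
  classical
  intro i j
  rw [← prod_map_alternatingWord_two_mul, ← reverse_alternatingWord_two_mul]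
  ext1 ⟨t, ε⟩
  rw [prod_map_parityPerm_reverse_apply, M.symmetric i j, count_leftInvSeq_alternatingWord,
    ← M.symmetric i j]
  simp [prod_alternatingWord_eq_mul_pow]

open scoped Classical in
theorem count_leftInvSeq_eq_of_wordProd_eq {ω ω' : List B} (h : cs.wordProd ω = cs.wordProd ω')
    (t : W) : ((cs.leftInvSeq ω).count t : ZMod 2) = (cs.leftInvSeq ω').count t := by
  have lift_reverse (ω : List B) : (ω.reverse.map (parityPerm cs)).prod =
      cs.lift ⟨_, isLiftable_parityPerm cs⟩ (cs.wordProd ω)⁻¹ := by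
    rw [← wordProd_reverse, wordProd, map_list_prod, List.map_map]
    congr 2
    ext1 i
    exact (cs.lift_apply_simple (isLiftable_parityPerm cs) i).symm
  have heq : (ω.reverse.map (parityPerm cs)).prod (t, 0) =
      (ω'.reverse.map (parityPerm cs)).prod (t, 0) := by
    rw [lift_reverse, lift_reverse, h]
  rw [prod_map_parityPerm_reverse_apply, prod_map_parityPerm_reverse_apply] at heq
  simpa using congrArg Prod.snd heq

theorem exists_eraseIdx_of_isLeftDescent {ω : List B} {i : B}
    (h : cs.IsLeftDescent (cs.wordProd ω) i) :
    ∃ k < ω.length, cs.simple i * cs.wordProd ω = cs.wordProd (ω.eraseIdx k) := by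
  classical
  obtain ⟨ω', hω', hprod⟩ := cs.exists_isReduced (cs.simple i * cs.wordProd ω)
  have hcons : cs.wordProd (i :: ω') = cs.wordProd ω := by
    rw [wordProd_cons, ← hprod, simple_mul_simple_cancel_left]
  have hred : cs.IsReduced (i :: ω') := by
    rw [CoxeterSystem.IsReduced, hcons, List.length_cons, ← hω'.eq, ← hprod]
    exact (cs.isLeftDescent_iff.1 h).symm
  have hcount := count_leftInvSeq_eq_of_wordProd_eq cs hcons (cs.simple i)
  rw [List.count_eq_one_of_mem hred.nodup_leftInvSeq (by simp [leftInvSeq])] at hcount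
  have hmem : cs.simple i ∈ cs.leftInvSeq ω := by
    by_contra hnot
    simp [List.count_eq_zero_of_not_mem hnot] at hcount
  obtain ⟨k, hk, hki⟩ := List.mem_iff_getElem.1 hmem
  refine ⟨k, by simpa using hk, ?_⟩
  rw [← getD_leftInvSeq_mul_wordProd, List.getD_eq_getElem _ _ hk, hki]

theorem exists_wordProd_cons_cons_eraseIdx_of_isLeftDescent
    (hinj : Function.Injective cs.simple) {i j : B} (hij : i ≠ j) {ω : List B}
    (h : cs.IsLeftDescent (cs.wordProd (j :: ω)) i) :
    ∃ k < ω.length, cs.wordProd (j :: ω) = cs.wordProd (i :: j :: ω.eraseIdx k) := by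
  obtain ⟨k, hk, hprod⟩ := exists_eraseIdx_of_isLeftDescent cs h
  rcases k with _ | k
  · rw [wordProd_cons, List.eraseIdx_cons_zero, ← mul_assoc, mul_eq_right,
      mul_eq_one_iff_eq_inv, inv_simple] at hprod
    exact absurd (hinj hprod) hij
  · refine ⟨k, by simpa using hk, ?_⟩
    rw [cs.wordProd_cons i, ← List.eraseIdx_cons_succ, ← hprod, simple_mul_simple_cancel_left]

theorem isReduced_of_cons {i : B} {ω : List B} (h : cs.IsReduced (i :: ω)) : cs.IsReduced ω := by
  simpa using h.drop 1

theorem isLeftDescent_of_isReduced_cons {i : B} {ω : List B} (h : cs.IsReduced (i :: ω)) :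
    cs.IsLeftDescent (cs.wordProd (i :: ω)) i := by
  rw [IsLeftDescent, h.eq, wordProd_cons, simple_mul_simple_cancel_left,
    (isReduced_of_cons cs h).eq, List.length_cons]
  exact Nat.lt_succ_self _

/-- The products of `f` along any two reduced words of length `N` of the same element agree. -/
def ProdEqOnReducedWords (f : B → G) (N : ℕ) : Prop :=
  ∀ ⦃ω ω' : List B⦄, cs.IsReduced ω → cs.IsReduced ω' → ω.length = N →
    cs.wordProd ω = cs.wordProd ω' → (ω.map f).prod = (ω'.map f).prod

variable {cs}

namespace ProdEqOnReducedWords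

variable {f : B → G} {N : ℕ} (hN : ProdEqOnReducedWords cs f N)
include hN

theorem prod_map_cons_eq {i : B} {u v : List B} (hu : cs.IsReduced (i :: u)) (hlen : u.length = N)
    (hlen' : v.length = N) (h : cs.wordProd (i :: u) = cs.wordProd (i :: v)) :
    ((i :: u).map f).prod = ((i :: v).map f).prod := by
  have huv : cs.wordProd u = cs.wordProd v := by
    simpa only [wordProd_cons, mul_right_inj] using h
  have hu' := isReduced_of_cons cs hu
  have hv' : cs.IsReduced v := by rw [CoxeterSystem.IsReduced, ← huv, hu'.eq, hlen, hlen']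
  rw [List.map_cons, List.map_cons, List.prod_cons, List.prod_cons, hN hu' hv' hlen huv]

theorem prod_map_eq_of_commute (hinj : Function.Injective cs.simple) {i j : B} (hij : i ≠ j)
    (hs : Commute (cs.simple i) (cs.simple j)) (hf : Commute (f i) (f j)) {u v : List B}
    (hu : cs.IsReduced (i :: u)) (hv : cs.IsReduced (j :: v)) (hulen : u.length = N)
    (hvlen : v.length = N) (h : cs.wordProd (i :: u) = cs.wordProd (j :: v)) :
    ((i :: u).map f).prod = ((j :: v).map f).prod := by
  obtain ⟨k, hk, hi⟩ := exists_wordProd_cons_cons_eraseIdx_of_isLeftDescent cs hinj hij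
    (h ▸ isLeftDescent_of_isReduced_cons cs hu)
  set w := v.eraseIdx k
  have hwlen : w.length + 1 = v.length := List.length_eraseIdx_add_one hk
  have hswap : cs.wordProd (i :: j :: w) = cs.wordProd (j :: i :: w) := by
    simp only [wordProd_cons, ← mul_assoc, hs.eq]
  calc ((i :: u).map f).prod = ((i :: j :: w).map f).prod :=
        hN.prod_map_cons_eq hu hulen (by simp; omega) (h.trans hi)
    _ = ((j :: i :: w).map f).prod := by simp only [List.map_cons, List.prod_cons, hf.left_comm]
    _ = ((j :: v).map f).prod :=
        (hN.prod_map_cons_eq hv hvlen (by simp; omega) (hi.trans hswap)).symm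

theorem prod_map_eq_of_braid (hinj : Function.Injective cs.simple) {i j : B}
    (hcomm : ¬ Commute (cs.simple i) (cs.simple j))
    (hs : cs.simple i * cs.simple j * cs.simple i = cs.simple j * cs.simple i * cs.simple j)
    (hf : f i * f j * f i = f j * f i * f j) {u v : List B}
    (hu : cs.IsReduced (i :: u)) (hv : cs.IsReduced (j :: v)) (hulen : u.length = N)
    (hvlen : v.length = N) (h : cs.wordProd (i :: u) = cs.wordProd (j :: v)) :
    ((i :: u).map f).prod = ((j :: v).map f).prod := by
  have hij : i ≠ j := by rintro rfl; exact hcomm (Commute.refl _)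
  obtain ⟨k, hk, hi⟩ := exists_wordProd_cons_cons_eraseIdx_of_isLeftDescent cs hinj hij
    (h ▸ isLeftDescent_of_isReduced_cons cs hu)
  set w := v.eraseIdx k
  have hwlen : w.length + 1 = v.length := List.length_eraseIdx_add_one hk
  obtain ⟨l, hl, hj⟩ := exists_wordProd_cons_cons_eraseIdx_of_isLeftDescent cs hinj hij.symm
    (hi ▸ isLeftDescent_of_isReduced_cons cs hv)
  rcases l with _ | l
  · rw [commute_iff_eq] at hcomm
    refine absurd ?_ hcomm
    simpa only [List.eraseIdx_cons_zero, wordProd_cons, ← mul_assoc, mul_left_inj] using hj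
  rw [List.eraseIdx_cons_succ] at hj
  set x := w.eraseIdx l
  have hxlen : x.length + 1 = w.length := List.length_eraseIdx_add_one (by simpa using hl)
  have hswap : cs.wordProd (j :: i :: j :: x) = cs.wordProd (i :: j :: i :: x) := by
    simp only [wordProd_cons, ← mul_assoc, hs]
  calc ((i :: u).map f).prod = ((i :: j :: i :: x).map f).prod :=
        hN.prod_map_cons_eq hu hulen (by simp; omega) (h.trans (hi.trans (hj.trans hswap)))
    _ = ((j :: i :: j :: x).map f).prod := by
        simp only [List.map_cons, List.prod_cons, ← mul_assoc, hf]
    _ = ((j :: v).map f).prod :=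
        (hN.prod_map_cons_eq hv hvlen (by simp; omega) (hi.trans hj)).symm

end ProdEqOnReducedWords

variable (cs)

/-- Matsumoto's theorem for simply laced Coxeter systems. -/
theorem prod_map_eq_of_isReduced_of_simplyLaced {f : B → G} (hinj : Function.Injective cs.simple)
    (hf : ∀ i j, i ≠ j →
      Commute (cs.simple i) (cs.simple j) ∧ Commute (f i) (f j) ∨
      ¬ Commute (cs.simple i) (cs.simple j) ∧
        cs.simple i * cs.simple j * cs.simple i = cs.simple j * cs.simple i * cs.simple j ∧
        f i * f j * f i = f j * f i * f j)
    {ω ω' : List B} (hω : cs.IsReduced ω) (hω' : cs.IsReduced ω')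
    (h : cs.wordProd ω = cs.wordProd ω') : (ω.map f).prod = (ω'.map f).prod := by
  suffices ∀ N, ProdEqOnReducedWords cs f N from this _ hω hω' rfl h
  intro N
  induction N with
  | zero =>
    intro ω ω' hω hω' hlen h
    have hlen' : ω'.length = 0 := by rw [← hω'.eq, ← h, hω.eq, hlen]
    rw [List.length_eq_zero_iff.1 hlen, List.length_eq_zero_iff.1 hlen']
  | succ N ih =>
    intro ω ω' hω hω' hlen h
    have hlen' : ω'.length = N + 1 := by rw [← hω'.eq, ← h, hω.eq, hlen]
    obtain ⟨i, u, rfl⟩ := List.exists_cons_of_length_eq_add_one hlen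
    obtain ⟨j, v, rfl⟩ := List.exists_cons_of_length_eq_add_one hlen'
    simp only [List.length_cons, add_left_inj] at hlen hlen'
    rcases eq_or_ne i j with rfl | hij
    · exact ih.prod_map_cons_eq hω hlen hlen' h
    rcases hf i j hij with ⟨hs, hcomm⟩ | ⟨hs, hbraid, hfbraid⟩
    · exact ih.prod_map_eq_of_commute hinj hij hs hcomm hω hω' hlen hlen' h
    · exact ih.prod_map_eq_of_braid hinj hs hbraid hfbraid hω hω' hlen hlen' h

end Coxeter

variable {n : ℕ}

section AffinePermutations

theorem functionEnd_mul_apply {α : Type*} (f g : Function.End α) (a : α) : (f * g) a = f (g a) :=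
  rfl

theorem functionEnd_one_apply {α : Type*} (a : α) : (1 : Function.End α) a = a := rfl

theorem zmod_one_ne_zero (hn : 2 ≤ n) : (1 : ZMod n) ≠ 0 :=
  have : Fact (1 < n) := ⟨hn⟩
  one_ne_zero

theorem zmod_one_add_one_ne_zero (hn : 3 ≤ n) : (1 : ZMod n) + 1 ≠ 0 := by
  rw [one_add_one_eq_two, ← Nat.cast_ofNat, Ne, ZMod.natCast_eq_zero_iff]
  exact fun h => absurd (Nat.le_of_dvd two_pos h) (by omega)

theorem eq_of_intCast_eq_of_abs_sub_lt {v w : ℤ} (h : (v : ZMod n) = w) (hlt : |v - w| < n) :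
    v = w := by
  rw [ZMod.intCast_eq_intCast_iff_dvd_sub] at h
  rw [abs_sub_comm] at hlt
  exact (sub_eq_zero.1 (Int.eq_zero_of_abs_lt_dvd h hlt)).symm

/-- The affine permutation of `ℤ` which exchanges `v` and `v + 1` for all `v ≡ j` modulo `n`. -/
def affineSimple (j : ZMod n) : Function.End ℤ := fun v =>
  if (v : ZMod n) = j then v + 1 else if (v : ZMod n) = j + 1 then v - 1 else v

theorem affineSimple_apply (j : ZMod n) (v : ℤ) : affineSimple j v =
    if (v : ZMod n) = j then v + 1 else if (v : ZMod n) = j + 1 then v - 1 else v := rfl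

theorem intCast_affineSimple (j : ZMod n) (v : ℤ) :
    (affineSimple j v : ZMod n) = Equiv.swap j (j + 1) (v : ZMod n) := by
  rw [affineSimple, Equiv.swap_apply_def]
  split_ifs with h h' <;> simp [*]

theorem affineSimple_intCast {a v : ℤ} (ha : |v - a| < n) (ha' : |v - (a + 1)| < n) :
    affineSimple (a : ZMod n) v = if v = a then v + 1 else if v = a + 1 then v - 1 else v := by
  have hcast : (a : ZMod n) + 1 = (a + 1 : ℤ) := by push_cast; rfl
  have cast_inj {b : ℤ} (hb : |v - b| < n) : (v : ZMod n) = b ↔ v = b :=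
    ⟨fun h => eq_of_intCast_eq_of_abs_sub_lt h hb, congrArg _⟩
  simp only [affineSimple_apply, hcast, cast_inj ha, cast_inj ha']

theorem affineSimple_add_natCast (j : ZMod n) (v : ℤ) :
    affineSimple j (v + n) = affineSimple j v + n := by
  simp only [affineSimple_apply, Int.cast_add, Int.cast_natCast, ZMod.natCast_self, add_zero]
  split_ifs <;> ring

theorem affineSimple_le_succ (j : ZMod n) (v : ℤ) : affineSimple j v ≤ v + 1 := by
  rw [affineSimple_apply]
  split_ifs <;> omega

theorem pred_le_affineSimple (j : ZMod n) (v : ℤ) : v - 1 ≤ affineSimple j v := by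
  rw [affineSimple_apply]
  split_ifs <;> omega

theorem affineSimple_le {j : ZMod n} {v : ℤ} (h : (v : ZMod n) ≠ j) : affineSimple j v ≤ v := by
  rw [affineSimple_apply, if_neg h]
  split_ifs <;> omega

theorem le_affineSimple {j : ZMod n} {v : ℤ} (h : (v : ZMod n) ≠ j + 1) :
    v ≤ affineSimple j v := by
  rw [affineSimple_apply, if_neg h]
  split_ifs <;> omega

theorem affineSimple_mul_self (hn : 2 ≤ n) (j : ZMod n) : affineSimple j * affineSimple j = 1 := by
  have hone := zmod_one_ne_zero hn
  funext v
  simp only [functionEnd_mul_apply, affineSimple_apply, functionEnd_one_apply]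
  rcases eq_or_ne (v : ZMod n) j with hvj | hvj
  · simp [hvj, hone]
  rcases eq_or_ne (v : ZMod n) (j + 1) with hvj₁ | hvj₁
  · simp [hvj₁, hone]
  · simp [hvj, hvj₁]

theorem affineSimple_braid (hn : 3 ≤ n) (j : ZMod n) :
    affineSimple j * affineSimple (j + 1) * affineSimple j =
      affineSimple (j + 1) * affineSimple j * affineSimple (j + 1) := by
  have hone := zmod_one_ne_zero (n := n) (by omega)
  have hj : j + 1 + 1 ≠ j := by
    rw [add_assoc, Ne, add_eq_left]
    exact zmod_one_add_one_ne_zero hn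
  funext v
  simp only [functionEnd_mul_apply, affineSimple_apply]
  rcases eq_or_ne (v : ZMod n) j with hvj | hvj
  · simp [hvj, hone, hj, hj.symm]
  rcases eq_or_ne (v : ZMod n) (j + 1) with hvj₁ | hvj₁
  · simp [hvj₁, hone, hj, hj.symm]
  rcases eq_or_ne (v : ZMod n) (j + 1 + 1) with hvj₂ | hvj₂
  · simp [hvj₂, hone, hj, hj.symm]
  · simp [hvj, hvj₁, hvj₂]

theorem affineSimple_commute (hn : 2 ≤ n) {j k : ZMod n} (hjk : j ≠ k) (hk : k ≠ j + 1)
    (hj : j ≠ k + 1) : Commute (affineSimple j) (affineSimple k) := by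
  have hone := zmod_one_ne_zero hn
  funext v
  simp only [functionEnd_mul_apply, affineSimple_apply]
  rcases eq_or_ne (v : ZMod n) j with hvj | hvj
  · simp [hvj, hjk, hj, hk.symm]
  rcases eq_or_ne (v : ZMod n) (j + 1) with hvj₁ | hvj₁
  · simp [hvj₁, hone, hjk, hj, hk.symm]
  rcases eq_or_ne (v : ZMod n) k with hvk | hvk
  · simp [hvk, hjk.symm, hk, hj.symm]
  rcases eq_or_ne (v : ZMod n) (k + 1) with hvk₁ | hvk₁
  · simp [hvk₁, hone, hjk.symm, hk, hj.symm]
  · simp [hvj, hvj₁, hvk, hvk₁]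

theorem not_commute_affineSimple_add_one (hn : 3 ≤ n) (j : ZMod n) :
    ¬ Commute (affineSimple j) (affineSimple (j + 1)) := by
  intro h
  obtain ⟨v, rfl⟩ := ZMod.intCast_surjective j
  have hv : affineSimple (v : ZMod n) (affineSimple ((v : ZMod n) + 1) v) =
      affineSimple ((v : ZMod n) + 1) (affineSimple (v : ZMod n) v) := congrFun h.eq v
  simp [affineSimple_apply, add_assoc, zmod_one_ne_zero (n := n) (by omega),
    zmod_one_add_one_ne_zero hn] at hv

theorem affineSimple_injective :
    Function.Injective (affineSimple : ZMod n → Function.End ℤ) := by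
  intro j k h
  obtain ⟨v, rfl⟩ := ZMod.intCast_surjective j
  have hv : affineSimple (v : ZMod n) v = affineSimple k v := congrFun h v
  by_contra hne
  have := affineSimple_le hne
  rw [← hv, affineSimple_apply, if_pos rfl] at this
  omega

theorem prod_affineSimple_cons_apply (j : ZMod n) (ω : List (ZMod n)) (v : ℤ) :
    ((j :: ω).map affineSimple).prod v = affineSimple j ((ω.map affineSimple).prod v) := by
  rw [List.map_cons, List.prod_cons, functionEnd_mul_apply]

theorem prod_affineSimple_append_apply (ω ω' : List (ZMod n)) (v : ℤ) :
    ((ω ++ ω').map affineSimple).prod v =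
      (ω.map affineSimple).prod ((ω'.map affineSimple).prod v) := by
  rw [List.map_append, List.prod_append, functionEnd_mul_apply]

theorem prod_affineSimple_add_natCast (ω : List (ZMod n)) (v : ℤ) :
    (ω.map affineSimple).prod (v + n) = (ω.map affineSimple).prod v + n := by
  induction ω with
  | nil => rfl
  | cons j ω ih =>
    rw [prod_affineSimple_cons_apply, prod_affineSimple_cons_apply, ih, affineSimple_add_natCast]

theorem intCast_prod_affineSimple (ω : List (ZMod n)) (v : ℤ) :
    ((ω.map affineSimple).prod v : ZMod n) =
      (ω.map fun j => Equiv.swap j (j + 1)).prod (v : ZMod n) := by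
  induction ω with
  | nil => rfl
  | cons j ω ih =>
    rw [prod_affineSimple_cons_apply, intCast_affineSimple, ih, List.map_cons, List.prod_cons,
      Equiv.Perm.mul_apply]

theorem injOn_intCast_prod_affineSimple (ω : List (ZMod n)) :
    Set.InjOn (fun v : ℤ => ((ω.map affineSimple).prod v : ZMod n)) (Set.Icc 1 n) := by
  intro v ⟨hv, hvn⟩ w ⟨hw, hwn⟩ h
  simp only [intCast_prod_affineSimple] at h
  exact eq_of_intCast_eq_of_abs_sub_lt (Equiv.injective _ h) (by rw [abs_lt]; omega)

end AffinePermutations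

section AffineWeylGroup

theorem affineA_apply (j k : ZMod n) : affineA n j k =
    if j = k then 1 else if n = 2 then 0 else if k = j + 1 ∨ j = k + 1 then 3 else 2 := rfl

theorem mul_pow_three_eq_one_of_braid {G : Type*} [Monoid G] {a b : G} (ha : a * a = 1)
    (hb : b * b = 1) (h : a * b * a = b * a * b) : (a * b) ^ 3 = 1 :=
  calc (a * b) ^ 3 = (a * b * a) * (b * a * b) := by
        rw [pow_succ, pow_two]
        simp only [mul_assoc]
    _ = a * (b * (a * a) * b) * a := by rw [← h]; simp only [mul_assoc]
    _ = 1 := by rw [ha, mul_one, hb, mul_one, ha]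

theorem isLiftable_affineSimple (hn : 2 ≤ n) :
    (affineA n).IsLiftable (affineSimple : ZMod n → Function.End ℤ) := by
  intro j k
  rw [affineA_apply]
  split_ifs with h1 h2 h3
  · rw [h1, pow_one, affineSimple_mul_self hn]
  · rw [pow_zero]
  · refine mul_pow_three_eq_one_of_braid (affineSimple_mul_self hn j)
      (affineSimple_mul_self hn k) ?_
    rcases h3 with rfl | rfl
    · exact affineSimple_braid (by omega) j
    · exact (affineSimple_braid (by omega) k).symm
  · rw [not_or] at h3
    rw [(affineSimple_commute hn h1 h3.1 h3.2).mul_pow, pow_two, pow_two,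
      affineSimple_mul_self hn, affineSimple_mul_self hn, one_mul]

/-- The action of the affine Weyl group on `ℤ` by affine permutations. -/
noncomputable def affinePerm (hn : 2 ≤ n) : AffineWeyl n →* Function.End ℤ :=
  (affineSystem n).lift ⟨affineSimple, isLiftable_affineSimple hn⟩

theorem affinePerm_simple (hn : 2 ≤ n) (j : ZMod n) :
    affinePerm hn ((affineSystem n).simple j) = affineSimple j :=
  (affineSystem n).lift_apply_simple (isLiftable_affineSimple hn) j

theorem affinePerm_wordProd (hn : 2 ≤ n) (ω : List (ZMod n)) :
    affinePerm hn ((affineSystem n).wordProd ω) = (ω.map affineSimple).prod := by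
  rw [wordProd, map_list_prod, List.map_map]
  exact congrArg _ (List.map_congr_left fun j _ => affinePerm_simple hn j)

theorem affineSystem_simple_injective (hn : 2 ≤ n) : Function.Injective (affineSystem n).simple :=
  fun j k h => affineSimple_injective (by rw [← affinePerm_simple hn, h, affinePerm_simple])

theorem commute_affineSystem_simple (hn : 3 ≤ n) {j k : ZMod n} (hjk : j ≠ k) (hk : k ≠ j + 1)
    (hj : j ≠ k + 1) : Commute ((affineSystem n).simple j) ((affineSystem n).simple k) := by
  have h := (affineSystem n).simple_mul_simple_pow j k
  rw [affineA_apply, if_neg hjk, if_neg (by omega), if_neg (by tauto), pow_two] at h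
  rw [commute_iff_eq, eq_inv_of_mul_eq_one_left h, mul_inv_rev, inv_simple, inv_simple]

theorem not_commute_affineSystem_simple_add_one (hn : 3 ≤ n) (j : ZMod n) :
    ¬ Commute ((affineSystem n).simple j) ((affineSystem n).simple (j + 1)) := by
  intro h
  have hmap := h.map (affinePerm (by omega : 2 ≤ n))
  rw [affinePerm_simple, affinePerm_simple] at hmap
  exact not_commute_affineSimple_add_one hn j hmap

theorem affineSystem_simple_braid (hn : 3 ≤ n) (j : ZMod n) :
    (affineSystem n).simple j * (affineSystem n).simple (j + 1) * (affineSystem n).simple j =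
      (affineSystem n).simple (j + 1) * (affineSystem n).simple j *
        (affineSystem n).simple (j + 1) := by
  have hj : j ≠ j + 1 := by simpa using zmod_one_ne_zero (n := n) (by omega)
  have h := (affineSystem n).simple_mul_simple_pow j (j + 1)
  rw [affineA_apply, if_neg hj, if_neg (by omega), if_pos (Or.inl rfl), pow_succ, pow_two] at h
  rw [eq_inv_of_mul_eq_one_left (Eq.trans (by simp only [mul_assoc]) h :
    (affineSystem n).simple j * (affineSystem n).simple (j + 1) * (affineSystem n).simple j *
      ((affineSystem n).simple (j + 1) * (affineSystem n).simple j *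
        (affineSystem n).simple (j + 1)) = 1)]
  simp only [mul_inv_rev, inv_simple, mul_assoc]

theorem prod_map_eq_of_isReduced_affineSystem {G : Type*} [Monoid G] (hn : 3 ≤ n) {f : ZMod n → G}
    (hcomm : ∀ j k, j ≠ k → k ≠ j + 1 → j ≠ k + 1 → Commute (f j) (f k))
    (hbraid : ∀ j, f j * f (j + 1) * f j = f (j + 1) * f j * f (j + 1))
    {ω ω' : List (ZMod n)} (hω : (affineSystem n).IsReduced ω) (hω' : (affineSystem n).IsReduced ω')
    (h : (affineSystem n).wordProd ω = (affineSystem n).wordProd ω') :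
    (ω.map f).prod = (ω'.map f).prod := by
  refine prod_map_eq_of_isReduced_of_simplyLaced _ (affineSystem_simple_injective (by omega))
    (fun j k hjk => ?_) hω hω' h
  rcases eq_or_ne k (j + 1) with rfl | hk
  · exact Or.inr ⟨not_commute_affineSystem_simple_add_one hn j, affineSystem_simple_braid hn j,
      hbraid j⟩
  rcases eq_or_ne j (k + 1) with rfl | hj
  · exact Or.inr ⟨fun h => not_commute_affineSystem_simple_add_one hn k h.symm,
      (affineSystem_simple_braid hn k).symm, (hbraid k).symm⟩
  · exact Or.inl ⟨commute_affineSystem_simple hn hjk hk hj, hcomm j k hjk hk hj⟩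

end AffineWeylGroup

section RectangleWords

theorem succ_ediv_le {d N : ℤ} (hN : 0 < N) (h : ¬ N ∣ d + 1) : (d + 1) / N ≤ d / N := by
  rw [Int.le_ediv_iff_mul_le hN]
  have hne : (d + 1) / N * N ≠ d + 1 := fun h' => h (Dvd.intro_left _ h')
  have := Int.ediv_mul_le (d + 1) hN.ne'
  omega

theorem ediv_affineSimple_sub_le (hn : 2 ≤ n) (j : ZMod n) (d k : ℤ) :
    (affineSimple j d - affineSimple j k) / (n : ℤ) ≤
      (d - k) / n + if (d : ZMod n) = j ∧ (k : ZMod n) = j + 1 then 1 else 0 := by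
  have hN : (0 : ℤ) < n := by omega
  have hd₁ := affineSimple_le_succ j d
  have hk₁ := pred_le_affineSimple j k
  have key (h : ¬ (n : ℤ) ∣ d - k + 1) (hle : affineSimple j d - affineSimple j k ≤ d - k + 1) :
      (affineSimple j d - affineSimple j k) / (n : ℤ) ≤ (d - k) / n :=
    (Int.ediv_le_ediv hN hle).trans (succ_ediv_le hN h)
  have dvd_iff : (n : ℤ) ∣ d - k + 1 ↔ (d : ZMod n) + 1 = k := by
    rw [← ZMod.intCast_zmod_eq_zero_iff_dvd]
    push_cast
    rw [sub_add_eq_add_sub, sub_eq_zero]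
  rcases eq_or_ne (d : ZMod n) j with hd | hd <;> rcases eq_or_ne (k : ZMod n) (j + 1) with hk | hk
  · rw [if_pos ⟨hd, hk⟩, ← Int.add_mul_ediv_left _ _ hN.ne']
    exact Int.ediv_le_ediv hN (by omega)
  · rw [if_neg fun h => hk h.2, add_zero]
    have := le_affineSimple hk
    exact key (by rw [dvd_iff, hd]; exact hk.symm) (by omega)
  · rw [if_neg fun h => hd h.1, add_zero]
    have := affineSimple_le hd
    exact key (by rw [dvd_iff, hk, add_left_inj]; exact hd) (by omega)
  · rw [if_neg fun h => hd h.1, add_zero]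
    have := affineSimple_le hd
    have := le_affineSimple hk
    exact Int.ediv_le_ediv hN (by omega)

/-- A signed count of the inversions of an affine permutation `g` between the blocks `[1, i]` and
`[i + 1, n]`. It bounds the length of `g` from below. -/
noncomputable def blockInv (n i : ℕ) (g : ℤ → ℤ) : ℤ :=
  ∑ p ∈ Finset.Icc (1 : ℤ) i ×ˢ Finset.Icc ((i : ℤ) + 1) n, (g p.2 - g p.1) / (n : ℤ)

theorem blockInv_affineSimple_mul_le (hn : 2 ≤ n) (i : ℕ) (j : ZMod n) {g : Function.End ℤ}
    (hg : Set.InjOn (fun v => (g v : ZMod n)) (Set.Icc 1 n)) :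
    blockInv n i (affineSimple j * g : Function.End ℤ) ≤ blockInv n i g + 1 := by
  have hcard : (∑ p ∈ Finset.Icc (1 : ℤ) i ×ˢ Finset.Icc ((i : ℤ) + 1) n,
      if (g p.2 : ZMod n) = j ∧ (g p.1 : ZMod n) = j + 1 then (1 : ℤ) else 0) ≤ 1 := by
    rw [Finset.sum_boole]
    norm_cast
    refine Finset.card_le_one.2 fun p hp q hq => ?_
    simp only [Finset.mem_filter, Finset.mem_product, Finset.mem_Icc] at hp hq
    ext
    · exact hg (by constructor <;> omega) (by constructor <;> omega) (hp.2.2.trans hq.2.2.symm)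
    · exact hg (by constructor <;> omega) (by constructor <;> omega) (hp.2.1.trans hq.2.1.symm)
  refine le_trans ?_ (add_le_add_right hcard _)
  simp only [blockInv]
  rw [← Finset.sum_add_distrib]
  exact Finset.sum_le_sum fun p _ => ediv_affineSimple_sub_le hn j (g p.2) (g p.1)

theorem blockInv_one (i : ℕ) : blockInv n i (1 : Function.End ℤ) = 0 := by
  refine Finset.sum_eq_zero fun p hp => ?_
  rw [Finset.mem_product, Finset.mem_Icc, Finset.mem_Icc] at hp
  exact Int.ediv_eq_zero_of_lt (by simp only [functionEnd_one_apply]; omega)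
    (by simp only [functionEnd_one_apply]; omega)

theorem blockInv_prod_affineSimple_le (hn : 2 ≤ n) (i : ℕ) (ω : List (ZMod n)) :
    blockInv n i (ω.map affineSimple).prod ≤ ω.length := by
  induction ω with
  | nil => exact (blockInv_one i).le
  | cons j ω ih =>
    rw [List.map_cons, List.prod_cons, List.length_cons, Nat.cast_add_one]
    exact (blockInv_affineSimple_mul_le hn i j (injOn_intCast_prod_affineSimple ω)).trans
      (by omega)

/-- The residues of the first `c` boxes of row `r`, read from right to left. -/
def rowWord (n r c : ℕ) : List (ZMod n) := (List.range c).reverse.map fun c => res n r c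

/-- The residues of the boxes of the rectangle with `m` rows of length `i`, read from the bottom
row to the top row. -/
def rectWord (n i m : ℕ) : List (ZMod n) := (List.range m).reverse.flatMap fun r => rowWord n r i

theorem rowWord_succ (r c : ℕ) : rowWord n r (c + 1) = res n r c :: rowWord n r c := by
  simp [rowWord, List.range_succ]

theorem rectWord_succ (i m : ℕ) : rectWord n i (m + 1) = rowWord n m i ++ rectWord n i m := by
  simp [rectWord, List.range_succ]

theorem length_rectWord (i m : ℕ) : (rectWord n i m).length = m * i := by
  simp [rectWord, rowWord, List.length_flatMap]

theorem prod_affineSimple_rowWord {r c : ℕ} (hc : c < n) {v : ℤ} (h1 : -(r : ℤ) ≤ v)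
    (h2 : v < (n : ℤ) - r) :
    ((rowWord n r c).map affineSimple).prod v =
      if v = -r then (c : ℤ) - r else if v ≤ (c : ℤ) - r then v - 1 else v := by
  induction c with
  | zero =>
    rw [rowWord, List.range_zero, List.reverse_nil, List.map_nil, List.map_nil, List.prod_nil,
      functionEnd_one_apply]
    split_ifs <;> omega
  | succ c ih =>
    rw [rowWord_succ, prod_affineSimple_cons_apply, ih (by omega),
      show res n r c = ((c - r : ℤ) : ZMod n) by simp [res]]
    rw [affineSimple_intCast] <;> first | rw [abs_lt] | push_cast
    all_goals split_ifs <;> omega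

theorem prod_affineSimple_rectWord {i m : ℕ} (hi : 1 ≤ i) (him : i + m ≤ n) {v : ℤ}
    (h1 : (i : ℤ) - n < v) (h2 : v ≤ i) :
    ((rectWord n i m).map affineSimple).prod v =
      if 1 ≤ v then v - m else if -(m : ℤ) < v then v + i else v := by
  induction m with
  | zero =>
    rw [rectWord, List.range_zero, List.reverse_nil, List.flatMap_nil, List.map_nil, List.prod_nil,
      functionEnd_one_apply]
    push_cast
    split_ifs <;> omega
  | succ m ih =>
    rw [rectWord_succ, prod_affineSimple_append_apply, ih (by omega)]
    by_cases hv : -(m : ℤ) ≤ v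
    · rw [prod_affineSimple_rowWord (by omega)] <;> push_cast <;> split_ifs <;> omega
    · have hshift := prod_affineSimple_add_natCast (rowWord n m i) v
      rw [prod_affineSimple_rowWord (by omega) (by omega) (by omega), if_neg (by omega),
        if_neg (by omega)] at hshift
      push_cast
      split_ifs <;> omega

theorem blockInv_rectWord {i m : ℕ} (hi : 1 ≤ i) (him : i + m = n) :
    blockInv n i ((rectWord n i m).map affineSimple).prod = (m * i : ℕ) := by
  have hval : ∀ p ∈ Finset.Icc (1 : ℤ) i ×ˢ Finset.Icc ((i : ℤ) + 1) n,
      (((rectWord n i m).map affineSimple).prod p.2 -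
        ((rectWord n i m).map affineSimple).prod p.1) / (n : ℤ) = 1 := by
    intro p hp
    rw [Finset.mem_product, Finset.mem_Icc, Finset.mem_Icc] at hp
    have hshift := prod_affineSimple_add_natCast (rectWord n i m) (p.2 - n)
    rw [sub_add_cancel, prod_affineSimple_rectWord (v := p.2 - n) hi him.le (by omega) (by omega),
      if_neg (by omega), if_pos (by omega)] at hshift
    rw [hshift, prod_affineSimple_rectWord hi him.le (by omega) (by omega), if_pos (by omega),
      show p.2 - n + i + n - (p.1 - m) = (p.2 - p.1) + n * 1 by rw [← him]; push_cast; ring,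
      Int.add_mul_ediv_left _ _ (by omega), Int.ediv_eq_zero_of_lt (by omega) (by omega), zero_add]
  simp only [blockInv]
  rw [Finset.sum_congr rfl hval, Finset.sum_const, Finset.card_product, Int.card_Icc,
    Int.card_Icc, nsmul_one, show ((i : ℤ) + 1 - 1).toNat = i by omega,
    show ((n : ℤ) + 1 - (i + 1)).toNat = m by omega, mul_comm]

theorem isReduced_rectWord (hn : 2 ≤ n) {i m : ℕ} (hi : 1 ≤ i) (him : i + m = n) :
    (affineSystem n).IsReduced (rectWord n i m) := by
  refine le_antisymm ((affineSystem n).length_wordProd_le _) ?_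
  obtain ⟨ω, hω, hprod⟩ :=
    (affineSystem n).exists_isReduced ((affineSystem n).wordProd (rectWord n i m))
  have hle := blockInv_prod_affineSimple_le hn i ω
  rw [← affinePerm_wordProd hn, ← hprod, affinePerm_wordProd, blockInv_rectWord hi him,
    Nat.cast_le] at hle
  rwa [hprod, hω.eq, length_rectWord]

theorem colLen_kRect {i : ℕ} (hi : 1 ≤ i) : (kRect n i).colLen 0 = n - i := by
  rw [← YoungDiagram.length_rowLens, kRect, YoungDiagram.rowLens_ofRowLens_eq_self,
    List.length_replicate]
  intro x hx
  rwa [List.eq_of_mem_replicate hx]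

theorem rowLen_kRect {i r : ℕ} (hr : r < n - i) : (kRect n i).rowLen r = i :=
  (YoungDiagram.rowLen_ofRowLens (w := List.replicate (n - i) i)
    (hw := List.Pairwise.sortedGE (List.pairwise_replicate.2 (Or.inr le_rfl)))
    ⟨r, by simpa using hr⟩).trans (by simp)

theorem residueWord_kRect {i : ℕ} (hi : 1 ≤ i) :
    residueWord n (kRect n i) = rectWord n i (n - i) := by
  rw [residueWord, rectWord, colLen_kRect hi]
  refine List.flatMap_congr fun r hr => ?_
  rw [rowLen_kRect (by simpa using hr), rowWord]

end RectangleWords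

section DividedDifferences

variable {B : Type*} [CommRing B] {σ τ : B →+* B} {x y z w : B} {D E : B → B}

/-- `D` is the isobaric divided difference `f ↦ (x s(f) - y f) / (x - y)`; the equation is
multiplied by `x - y` because the quotient need not exist for a general `s`. -/
def IsDividedDifference (x y : B) (s D : B → B) : Prop :=
  ∀ f, (x - y) * D f = x * s f - y * f

theorem semilinear_map_mul (s : B →ₛₗ[σ] B) (c f : B) : s (c * f) = σ c * s f :=
  s.map_smulₛₗ c f

theorem IsDividedDifference.map {s : B → B} (hD : IsDividedDifference x y s D) (t : B →ₛₗ[τ] B)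
    (f : B) : (τ x - τ y) * t (D f) = τ x * t (s f) - τ y * t f := by
  simpa only [map_sub, semilinear_map_mul] using congrArg t (hD f)

variable [NoZeroDivisors B] {s : B →ₛₗ[σ] B} {t : B →ₛₗ[τ] B}

theorem IsDividedDifference.map_eq_self (hD : IsDividedDifference x y s D) (hxy : x ≠ y)
    (hσx : σ x = y) (hσy : σ y = x) (hs : Function.Involutive s) (f : B) : s (D f) = D f := by
  have hsD := hD.map s f
  rw [hσx, hσy, hs f] at hsD
  exact mul_left_cancel₀ (sub_ne_zero.2 hxy) (by linear_combination -hD f - hsD)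

theorem IsDividedDifference.eq_self_of_map_eq_self {s : B → B} (hD : IsDividedDifference x y s D)
    (hxy : x ≠ y) {f : B} (hf : s f = f) : D f = f :=
  mul_left_cancel₀ (sub_ne_zero.2 hxy) (by rw [hD, hf, sub_mul])

theorem IsDividedDifference.comm (hD : IsDividedDifference x y s D)
    (hE : IsDividedDifference z w t E) (hxy : x ≠ y) (hzw : z ≠ w) (hσz : σ z = z) (hσw : σ w = w)
    (hτx : τ x = x) (hτy : τ y = y) (hst : ∀ f, s (t f) = t (s f)) (f : B) :
    D (E f) = E (D f) := by
  have hsE := hE.map s f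
  have htD := hD.map t f
  rw [hσz, hσw, hst] at hsE
  rw [hτx, hτy] at htD
  refine mul_left_cancel₀ (mul_ne_zero (sub_ne_zero.2 hxy) (sub_ne_zero.2 hzw)) ?_
  linear_combination (z - w) * hD (E f) + x * hsE - y * hE f - (x - y) * hE (D f) - z * htD
    + w * hD f

-- Up to a factor, `D E D` and `E D E` both antisymmetrize `x² y f` over the group generated by
-- `s` and `t`: this is the source of the braid relation.
theorem vandermonde_mul_left_braid (hD : IsDividedDifference x y s D)
    (hE : IsDividedDifference y z t E) (hxy : x ≠ y) (hσx : σ x = y) (hσy : σ y = x)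
    (hσz : σ z = z) (hτx : τ x = x) (hτy : τ y = z) (hs : Function.Involutive s) (f : B) :
    (x - y) * (y - z) * (x - z) * D (E (D f)) =
      x ^ 2 * (y * s (t (s f)) - z * s (t f)) - y ^ 2 * (x * t (s f) - z * t f) +
        z ^ 2 * (x * s f - y * f) := by
  have hsED := hE.map s (D f)
  have htD := hD.map t f
  have hstD := congrArg s htD
  simp only [map_sub, semilinear_map_mul, hσx, hσy, hσz, hτx, hτy,
    hD.map_eq_self hxy hσx hσy hs f] at hsED htD hstD
  linear_combination (y - z) * (x - z) * hD (E (D f)) + x * (y - z) * hsED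
    - y * (x - z) * hE (D f) + x ^ 2 * hstD - y ^ 2 * htD + z ^ 2 * hD f

theorem vandermonde_mul_right_braid (hD : IsDividedDifference x y s D)
    (hE : IsDividedDifference y z t E) (hyz : y ≠ z) (hσy : σ y = x) (hσz : σ z = z)
    (hτx : τ x = x) (hτy : τ y = z) (hτz : τ z = y) (ht : Function.Involutive t) (f : B) :
    (x - y) * (y - z) * (x - z) * E (D (E f)) =
      x ^ 2 * (y * t (s (t f)) - z * s (t f)) - y ^ 2 * (x * t (s f) - z * t f) +
        z ^ 2 * (x * s f - y * f) := by
  have htDE := hD.map t (E f)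
  have hsE := hE.map s f
  have htsE := congrArg t hsE
  simp only [map_sub, semilinear_map_mul, hσy, hσz, hτx, hτy, hτz,
    hE.map_eq_self hyz hτy hτz ht f] at htDE hsE htsE
  linear_combination (x - y) * (x - z) * hE (D (E f)) + y * (x - y) * htDE
    - z * (x - z) * hD (E f) + x * y * htsE - x * z * hsE + y * z * hE f

theorem IsDividedDifference.braid (hD : IsDividedDifference x y s D)
    (hE : IsDividedDifference y z t E) (hxy : x ≠ y) (hyz : y ≠ z) (hxz : x ≠ z)
    (hσx : σ x = y) (hσy : σ y = x) (hσz : σ z = z) (hτx : τ x = x) (hτy : τ y = z) (hτz : τ z = y)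
    (hs : Function.Involutive s) (ht : Function.Involutive t)
    (hst : ∀ f, s (t (s f)) = t (s (t f))) (f : B) : D (E (D f)) = E (D (E f)) := by
  refine mul_left_cancel₀ (mul_ne_zero (mul_ne_zero (sub_ne_zero.2 hxy) (sub_ne_zero.2 hyz))
    (sub_ne_zero.2 hxz)) ?_
  rw [vandermonde_mul_left_braid hD hE hxy hσx hσy hσz hτx hτy hs,
    vandermonde_mul_right_braid hD hE hyz hσy hσz hτx hτy hτz ht, hst]

theorem commute_sub_one {R : Type*} [Ring R] {a b : R} (h : Commute a b) :
    Commute (a - 1) (b - 1) :=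
  (h.sub_right (Commute.one_right a)).sub_left (Commute.one_left _)

theorem braid_sub_one {R : Type*} [Ring R] {a b : R} (ha : a * a = a) (hb : b * b = b)
    (h : a * b * a = b * a * b) :
    (a - 1) * (b - 1) * (a - 1) = (b - 1) * (a - 1) * (b - 1) :=
  calc (a - 1) * (b - 1) * (a - 1) = a * b * a - a * b - b * a - a * a + 2 * a + b - 1 := by
        noncomm_ring
    _ = b * a * b - a * b - b * a - b * b + 2 * b + a - 1 := by
        rw [ha, hb, h]
        noncomm_ring
    _ = (b - 1) * (a - 1) * (b - 1) := by noncomm_ring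

end DividedDifferences

section PermutationAction

theorem permWeight_mul (w w' : Equiv.Perm (ZMod n)) (μ : Weight n) :
    permWeight (w * w') μ = permWeight w (permWeight w' μ) := by
  obtain ⟨v, rfl⟩ := QuotientAddGroup.mk_surjective μ
  rfl

theorem permWeight_one (μ : Weight n) : permWeight (1 : Equiv.Perm (ZMod n)) μ = μ := by
  obtain ⟨v, rfl⟩ := QuotientAddGroup.mk_surjective μ
  rfl

theorem RT_hom_ext {S : Type*} [CommRing S] {φ ψ : RT n →+* S} (h : ∀ μ, φ (ex μ) = ψ (ex μ)) :
    φ = ψ := by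
  refine AddMonoidAlgebra.ringHom_ext (R := ℤ) (M := Weight n) (fun c => ?_) h
  have hc : (AddMonoidAlgebra.single 0 c : AddMonoidAlgebra ℤ (Weight n)) = (c : RT n) :=
    (AddMonoidAlgebra.intCast_def c).symm
  have hint : φ (c : RT n) = ψ (c : RT n) := by rw [map_intCast, map_intCast]
  exact (congrArg φ hc).trans (hint.trans (congrArg ψ hc).symm)

theorem permRT_mul (w w' : Equiv.Perm (ZMod n)) (r : RT n) :
    permRT (w * w') r = permRT w (permRT w' r) := by
  have : permRT (w * w') = (permRT w).comp (permRT w') := RT_hom_ext fun μ => by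
    rw [RingHom.comp_apply, permRT_ex, permRT_ex, permRT_ex, permWeight_mul]
  rw [this, RingHom.comp_apply]

theorem permRT_one (r : RT n) : permRT (1 : Equiv.Perm (ZMod n)) r = r := by
  have : permRT (1 : Equiv.Perm (ZMod n)) = RingHom.id _ := RT_hom_ext fun μ => by
    rw [permRT_ex, permWeight_one, RingHom.id_apply]
  rw [this, RingHom.id_apply]

theorem permRT_bpar (w : Equiv.Perm (ZMod n)) (j : ZMod n) : permRT w (bpar j) = bpar (w j) := by
  rw [bpar, map_sub, map_one, permRT_ex, map_neg, permWeight_wt, bpar]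

theorem lambdaHat_ext {f g : LambdaHat n}
    (h : ∀ m, MvPowerSeries.coeff m f.1 = MvPowerSeries.coeff m g.1) : f = g :=
  Subtype.ext (MvPowerSeries.ext h)

/-- The action of a permutation of the indices on `Λ̂`, as a ring homomorphism. -/
noncomputable def permHom (w : Equiv.Perm (ZMod n)) : LambdaHat n →+* LambdaHat n where
  toFun := permLambda w
  map_one' := Subtype.ext (map_one (MvPowerSeries.map (permRT w)))
  map_zero' := Subtype.ext (map_zero (MvPowerSeries.map (permRT w)))
  map_mul' f g := Subtype.ext (map_mul (MvPowerSeries.map (permRT w)) f.1 g.1)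
  map_add' f g := Subtype.ext (map_add (MvPowerSeries.map (permRT w)) f.1 g.1)

theorem permHom_apply (w : Equiv.Perm (ZMod n)) (f : LambdaHat n) :
    permHom w f = permLambda w f := rfl

theorem permHom_mul (w w' : Equiv.Perm (ZMod n)) (f : LambdaHat n) :
    permHom (w * w') f = permHom w (permHom w' f) :=
  lambdaHat_ext fun m => permRT_mul w w' (MvPowerSeries.coeff m f.1)

theorem permHom_one (f : LambdaHat n) : permHom (1 : Equiv.Perm (ZMod n)) f = f :=
  lambdaHat_ext fun m => permRT_one (MvPowerSeries.coeff m f.1)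

theorem permHom_algebraMap (w : Equiv.Perm (ZMod n)) (r : RT n) :
    permHom w (algebraMap (RT n) (LambdaHat n) r) = algebraMap (RT n) (LambdaHat n) (permRT w r) :=
  Subtype.ext (MvPowerSeries.map_C (permRT w) r)

theorem permHom_Omega (w : Equiv.Perm (ZMod n)) (j : ZMod n) :
    permHom w (Omega (bpar j) : LambdaHat n) = (Omega (bpar (w j)) : LambdaHat n) :=
  lambdaHat_ext fun m => by
    change permRT w (bpar j ^ m.degree) = bpar (w j) ^ m.degree
    rw [map_pow, permRT_bpar]

/-- The element `e^{-a_j}` of `Λ̂`. -/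
noncomputable def xElt (j : ZMod n) : LambdaHat n := algebraMap (RT n) (LambdaHat n) (ex (-wt j))

theorem permHom_xElt (w : Equiv.Perm (ZMod n)) (j : ZMod n) :
    permHom w (xElt j) = xElt (w j) := by
  rw [xElt, permHom_algebraMap, permRT_ex, map_neg, permWeight_wt, xElt]

instance [NeZero n] : NoZeroDivisors (LambdaHat n) where
  eq_zero_or_eq_zero_of_mul_eq_zero {f g} h :=
    (mul_eq_zero.1 (congrArg Subtype.val h : f.1 * g.1 = 0)).imp Subtype.ext Subtype.ext

theorem algebraMap_lambdaHat_injective : Function.Injective (algebraMap (RT n) (LambdaHat n)) :=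
  fun _ _ h => MvPowerSeries.C_injective (congrArg Subtype.val h)

theorem ex_injective : Function.Injective (ex : Weight n → RT n) := fun _ _ h =>
  AddMonoidAlgebra.single_left_injective one_ne_zero h

theorem exists_zmod_ne_ne (hn : 3 ≤ n) (j k : ZMod n) : ∃ l : ZMod n, l ≠ j ∧ l ≠ k := by
  have : NeZero n := ⟨by omega⟩
  have hcard : ({j, k} : Finset (ZMod n)).card < (Finset.univ : Finset (ZMod n)).card := by
    rw [Finset.card_univ, ZMod.card]
    exact Finset.card_le_two.trans_lt (by omega)
  obtain ⟨l, -, hl⟩ := Finset.exists_mem_notMem_of_card_lt_card hcard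
  exact ⟨l, by simpa using hl⟩

theorem wt_injective (hn : 3 ≤ n) : Function.Injective (wt : ZMod n → Weight n) := by
  intro i j h
  by_contra hij
  rw [wt, wt, QuotientAddGroup.eq, AddSubgroup.mem_zmultiples_iff] at h
  obtain ⟨c, hc⟩ := h
  obtain ⟨k, hki, hkj⟩ := exists_zmod_ne_ne hn i j
  have hk := congrFun hc k
  have hi := congrFun hc i
  simp [hki, hkj, Ne.symm hij] at hk hi
  omega

theorem xElt_ne_xElt_add_one [NeZero n] (hn : 2 ≤ n) (j : ZMod n) : xElt j ≠ xElt (j + 1) := by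
  intro h
  refine one_sub_ex_simpleRoot_ne_zero hn j ?_
  rw [simpleRoot, neg_injective (ex_injective (algebraMap_lambdaHat_injective h)), sub_self,
    ex_zero, sub_self]

theorem xElt_injective (hn : 2 ≤ n) : Function.Injective (xElt : ZMod n → LambdaHat n) := by
  intro j k h
  rcases hn.lt_or_eq with hn | rfl
  · exact wt_injective hn (neg_injective (ex_injective (algebraMap_lambdaHat_injective h)))
  · obtain rfl | rfl := (by decide : ∀ j k : ZMod 2, j = k ∨ k = j + 1) j k
    · rfl
    · exact absurd h (xElt_ne_xElt_add_one le_rfl j)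

end PermutationAction

section SimpleReflections

/-- `s_j` as an endomorphism of `Λ̂` which is semilinear over the transposition of `a_j` and
`a_{j+1}`. -/
noncomputable def simpleReflHom (j : ZMod n) :
    LambdaHat n →ₛₗ[permHom (Equiv.swap j (j + 1))] LambdaHat n where
  toFun := simpleRefl j
  map_add' f g := by
    simp only [simpleRefl, ← permHom_apply, map_add, mul_add]
    split_ifs <;> rfl
  map_smul' c f := by
    simp only [simpleRefl, ← permHom_apply, smul_eq_mul, map_mul]
    split_ifs with h
    · subst h
      rw [zero_add, mul_left_comm]
    · rfl

theorem simpleReflHom_apply (j : ZMod n) (f : LambdaHat n) :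
    simpleReflHom j f = simpleRefl j f := rfl

/-- The product `Ω(b_0|y) Ω(b_{-1}|y) ⋯ Ω(b_{1-m}|y)`. -/
noncomputable def omegaProd (n m : ℕ) : (LambdaHat n)ˣ :=
  ∏ r ∈ Finset.range m, Omega (bpar (-(r : ZMod n)))

theorem coe_omegaProd (m : ℕ) : (omegaProd n m : LambdaHat n) =
    ∏ r ∈ Finset.range m, (Omega (bpar (-(r : ZMod n))) : LambdaHat n) := by
  rw [omegaProd, Units.coe_prod]

theorem xi_kRect {i : ℕ} (hi : 1 ≤ i) : xi (kRect n i) = omegaProd n (n - i) := by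
  simp only [xi, omegaProd, colLen_kRect hi, res, Nat.cast_zero, zero_sub]

theorem zmod_natCast_inj {a b : ℕ} (ha : a < n) (hb : b < n) : (a : ZMod n) = b ↔ a = b :=
  (CharP.natCast_injOn_Iio (ZMod n) n).eq_iff ha hb

theorem exists_neg_natCast [NeZero n] (j : ZMod n) : ∃ m < n, j = -(m : ZMod n) :=
  ⟨(-j).val, ZMod.val_lt _, by simp⟩

theorem swap_neg_natCast {t a : ℕ} (ht : t + 1 < n) (ha : a < n) :
    Equiv.swap (-((t + 1 : ℕ) : ZMod n)) (-((t + 1 : ℕ) : ZMod n) + 1) (-(a : ZMod n)) =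
      -((Equiv.swap t (t + 1) a : ℕ) : ZMod n) := by
  rw [show -((t + 1 : ℕ) : ZMod n) + 1 = -(t : ZMod n) by push_cast; ring, Equiv.swap_apply_def,
    Equiv.swap_apply_def]
  simp only [neg_inj, zmod_natCast_inj ha ht, zmod_natCast_inj ha (by omega : t < n)]
  split_ifs <;> first | rfl | omega

theorem permHom_swap_prod_range [NeZero n] {F : ZMod n → LambdaHat n}
    (hF : ∀ w k, permHom w (F k) = F (w k)) {j : ZMod n} {m : ℕ} (hm : m < n)
    (hj : j ≠ -(m : ZMod n)) (hj0 : j ≠ 0) :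
    permHom (Equiv.swap j (j + 1)) (∏ r ∈ Finset.range m, F (-(r : ZMod n))) =
      ∏ r ∈ Finset.range m, F (-(r : ZMod n)) := by
  obtain ⟨_ | t, ht, rfl⟩ := exists_neg_natCast j
  · simp at hj0
  have hmt : m ≠ t + 1 := fun h => hj (by rw [h])
  rw [map_prod]
  refine Finset.prod_equiv (Equiv.swap t (t + 1)) (fun a => ?_) (fun a ha => ?_)
  · simp only [Finset.mem_range, Equiv.swap_apply_def]
    split_ifs <;> omega
  · rw [hF, swap_neg_natCast ht ((Finset.mem_range.1 ha).trans hm)]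

theorem permHom_omegaProd_of_ne [NeZero n] {j : ZMod n} {m : ℕ} (hm : m < n)
    (hj : j ≠ -(m : ZMod n)) (hj0 : j ≠ 0) :
    permHom (Equiv.swap j (j + 1)) (omegaProd n m : LambdaHat n) =
      (omegaProd n m : LambdaHat n) := by
  rw [coe_omegaProd]
  exact permHom_swap_prod_range permHom_Omega hm hj hj0

theorem permHom_omegaProd_zero {m : ℕ} (hm : m + 1 < n) :
    permHom (Equiv.swap (0 : ZMod n) 1) (omegaProd n (m + 1) : LambdaHat n) *
      (Omega (bpar (0 : ZMod n)) : LambdaHat n) =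
    (Omega (bpar (1 : ZMod n)) : LambdaHat n) * (omegaProd n (m + 1) : LambdaHat n) := by
  have hfix : ∀ a ∈ Finset.range m,
      Equiv.swap (0 : ZMod n) 1 (-((a + 1 : ℕ) : ZMod n)) = -((a + 1 : ℕ) : ZMod n) := by
    intro a ha
    rw [Finset.mem_range] at ha
    refine Equiv.swap_apply_of_ne_of_ne ?_ ?_
    · rw [ne_eq, neg_eq_zero, ← Nat.cast_zero, zmod_natCast_inj (by omega) (by omega)]
      omega
    · rw [ne_eq, neg_eq_iff_add_eq_zero, ← Nat.cast_add_one, ← Nat.cast_zero,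
        zmod_natCast_inj (by omega) (by omega)]
      omega
  rw [coe_omegaProd, map_prod]
  simp only [permHom_Omega]
  rw [Finset.prod_range_succ', Finset.prod_range_succ',
    Finset.prod_congr rfl fun a ha => by rw [hfix a ha], Nat.cast_zero, neg_zero,
    Equiv.swap_apply_left]
  ring

theorem omegaProd_mul_simpleRefl [NeZero n] {m : ℕ} (hm : m < n) {j : ZMod n}
    (hj : j ≠ -(m : ZMod n)) (f : LambdaHat n) :
    (omegaProd n m : LambdaHat n) * simpleRefl j f =
      permHom (Equiv.swap j (j + 1)) ((omegaProd n m : LambdaHat n) * f) := by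
  rw [map_mul, simpleRefl]
  split_ifs with h0
  · subst h0
    obtain ⟨t, rfl⟩ : ∃ t, m = t + 1 :=
      Nat.exists_eq_succ_of_ne_zero (fun h => hj (by simp [h]))
    rw [zero_add, ← mul_assoc, ← permHom_apply]
    congr 1
    rw [Units.val_mul, mul_left_comm, mul_left_comm, ← mul_assoc, Units.mul_inv_eq_iff_eq_mul,
      permHom_omegaProd_zero hm, mul_comm]
  · rw [permHom_omegaProd_of_ne hm hj h0, permHom_apply _ f]

theorem zmod_add_one_ne (hn : 2 ≤ n) (j : ZMod n) : j + 1 ≠ j := by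
  rw [ne_eq, add_eq_left]
  exact zmod_one_ne_zero hn

theorem zmod_add_one_add_one_ne (hn : 3 ≤ n) (j : ZMod n) : j + 1 + 1 ≠ j := by
  rw [add_assoc, ne_eq, add_eq_left]
  exact zmod_one_add_one_ne_zero hn

theorem simpleReflHom_involutive [NeZero n] (hn : 2 ≤ n) (j : ZMod n) :
    Function.Involutive (simpleReflHom j) := by
  intro f
  obtain ⟨m, hm, hjm⟩ := exists_neg_natCast (j + 1)
  have hj : j ≠ -(m : ZMod n) := by
    rw [← hjm]
    exact (zmod_add_one_ne hn j).symm
  refine (Units.mul_right_inj (omegaProd n m)).1 ?_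
  rw [simpleReflHom_apply, omegaProd_mul_simpleRefl hm hj, simpleReflHom_apply,
    omegaProd_mul_simpleRefl hm hj, ← permHom_mul, Equiv.swap_mul_self, permHom_one]

theorem exists_ne_neg_natCast (hn : 3 ≤ n) (j k : ZMod n) :
    ∃ m < n, j ≠ -(m : ZMod n) ∧ k ≠ -(m : ZMod n) := by
  have : NeZero n := ⟨by omega⟩
  obtain ⟨l, hlj, hlk⟩ := exists_zmod_ne_ne hn j k
  obtain ⟨m, hm, rfl⟩ := exists_neg_natCast l
  exact ⟨m, hm, hlj.symm, hlk.symm⟩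

theorem commute_swap_add_one (hn : 2 ≤ n) {j k : ZMod n} (hjk : j ≠ k) (hk : k ≠ j + 1)
    (hj : j ≠ k + 1) : Commute (Equiv.swap j (j + 1)) (Equiv.swap k (k + 1)) := by
  refine (Equiv.Perm.disjoint_swap_swap ?_).commute
  simp [hjk, hj, hk.symm, (zmod_add_one_ne hn _).symm]

theorem simpleReflHom_comm [NeZero n] (hn : 3 ≤ n) {j k : ZMod n} (hjk : j ≠ k) (hk : k ≠ j + 1)
    (hj : j ≠ k + 1) (f : LambdaHat n) :
    simpleReflHom j (simpleReflHom k f) = simpleReflHom k (simpleReflHom j f) := by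
  obtain ⟨m, hm, hjm, hkm⟩ := exists_ne_neg_natCast hn j k
  refine (Units.mul_right_inj (omegaProd n m)).1 ?_
  simp only [simpleReflHom_apply, omegaProd_mul_simpleRefl hm hjm, omegaProd_mul_simpleRefl hm hkm,
    ← permHom_mul, (commute_swap_add_one (by omega) hjk hk hj).eq]

theorem swap_add_one_braid (hn : 3 ≤ n) (j : ZMod n) :
    Equiv.swap j (j + 1) * (Equiv.swap (j + 1) (j + 1 + 1) * Equiv.swap j (j + 1)) =
      Equiv.swap (j + 1) (j + 1 + 1) * (Equiv.swap j (j + 1) * Equiv.swap (j + 1) (j + 1 + 1)) := by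
  have h₁ := zmod_add_one_ne (n := n) (by omega) j
  have h₂ := zmod_add_one_ne (n := n) (by omega) (j + 1)
  have h₃ := zmod_add_one_add_one_ne hn j
  have h := Equiv.swap_mul_swap_mul_swap h₂ h₃
  rw [Equiv.swap_comm (j + 1) j, Equiv.swap_comm (j + 1 + 1) (j + 1),
    Equiv.swap_comm j (j + 1 + 1)] at h
  rw [← mul_assoc, ← mul_assoc, Equiv.swap_mul_swap_mul_swap h₁.symm h₃.symm, h]

theorem simpleReflHom_braid [NeZero n] (hn : 3 ≤ n) (j : ZMod n) (f : LambdaHat n) :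
    simpleReflHom j (simpleReflHom (j + 1) (simpleReflHom j f)) =
      simpleReflHom (j + 1) (simpleReflHom j (simpleReflHom (j + 1) f)) := by
  obtain ⟨m, hm, hj, hk⟩ := exists_ne_neg_natCast hn j (j + 1)
  refine (Units.mul_right_inj (omegaProd n m)).1 ?_
  simp only [simpleReflHom_apply, omegaProd_mul_simpleRefl hm hj, omegaProd_mul_simpleRefl hm hk,
    ← permHom_mul, swap_add_one_braid hn j]

end SimpleReflections

section DemazureOperators

theorem xElt_sub_mul_demazureT [NeZero n] (j : ZMod n) (f : LambdaHat n) :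
    (xElt j - xElt (j + 1)) * demazureT j f = xElt j * (simpleRefl j f - f) := by
  rw [← demazureT_spec j f, Algebra.smul_def, ← mul_assoc, xElt, xElt, ← map_sub, ← map_mul,
    mul_sub, mul_one, ← ex_add, simpleRoot, neg_add_eq_sub, sub_sub_cancel_left]

theorem isDividedDifference_demazureD [NeZero n] (j : ZMod n) :
    IsDividedDifference (xElt j) (xElt (j + 1)) (simpleReflHom j) (demazureD j) := by
  intro f
  rw [demazureD, mul_add, xElt_sub_mul_demazureT, simpleReflHom_apply]
  ring

/-- The Demazure operator `D_j` as an additive endomorphism of `Λ̂`. -/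
noncomputable def demazureEnd [NeZero n] (hn : 2 ≤ n) (j : ZMod n) : AddMonoid.End (LambdaHat n) :=
  AddMonoidHom.mk' (demazureD j) fun f g => by
    refine mul_left_cancel₀ (sub_ne_zero.2 (xElt_ne_xElt_add_one hn j)) ?_
    rw [mul_add, isDividedDifference_demazureD, isDividedDifference_demazureD,
      isDividedDifference_demazureD, map_add]
    ring

theorem demazureEnd_apply [NeZero n] (hn : 2 ≤ n) (j : ZMod n) (f : LambdaHat n) :
    demazureEnd hn j f = demazureD j f := rfl

theorem demazureEnd_sub_one_apply [NeZero n] (hn : 2 ≤ n) (j : ZMod n) (f : LambdaHat n) :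
    (demazureEnd hn j - 1) f = demazureT j f :=
  add_sub_cancel_right _ _

theorem demazureEnd_mul_self [NeZero n] (hn : 2 ≤ n) (j : ZMod n) :
    demazureEnd hn j * demazureEnd hn j = demazureEnd hn j := by
  have hD := isDividedDifference_demazureD j
  have hne := xElt_ne_xElt_add_one hn j
  ext1 f
  refine hD.eq_self_of_map_eq_self hne
    (hD.map_eq_self hne ?_ ?_ (simpleReflHom_involutive hn j) f) <;> simp [permHom_xElt]

theorem commute_demazureEnd [NeZero n] (hn : 3 ≤ n) {j k : ZMod n} (hjk : j ≠ k) (hk : k ≠ j + 1)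
    (hj : j ≠ k + 1) :
    Commute (demazureEnd (by omega : 2 ≤ n) j) (demazureEnd (by omega : 2 ≤ n) k) := by
  have hjk' : j + 1 ≠ k + 1 := by simpa using hjk
  ext1 f
  refine (isDividedDifference_demazureD j).comm (isDividedDifference_demazureD k)
    (xElt_ne_xElt_add_one (by omega) j) (xElt_ne_xElt_add_one (by omega) k) ?_ ?_ ?_ ?_
    (simpleReflHom_comm hn hjk hk hj) f
  all_goals rw [permHom_xElt, Equiv.swap_apply_of_ne_of_ne]
  exacts [hjk.symm, hk, hj.symm, hjk'.symm, hjk, hj, hk.symm, hjk']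

theorem demazureEnd_braid [NeZero n] (hn : 3 ≤ n) (j : ZMod n) :
    demazureEnd (by omega) j * demazureEnd (by omega) (j + 1) * demazureEnd (by omega) j =
      demazureEnd (by omega) (j + 1) * demazureEnd (by omega) j *
        demazureEnd (by omega) (j + 1) := by
  have hn2 : 2 ≤ n := by omega
  have h₁ := zmod_add_one_ne hn2 j
  have h₂ := zmod_add_one_ne hn2 (j + 1)
  have h₃ := zmod_add_one_add_one_ne hn j
  ext1 f
  refine (isDividedDifference_demazureD j).braid (isDividedDifference_demazureD (j + 1))
    (xElt_ne_xElt_add_one hn2 j) (xElt_ne_xElt_add_one hn2 (j + 1))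
    (fun h => h₃ (xElt_injective hn2 h).symm) ?_ ?_ ?_ ?_ ?_ ?_
    (simpleReflHom_involutive hn2 j) (simpleReflHom_involutive hn2 (j + 1))
    (simpleReflHom_braid hn j) f
  all_goals rw [permHom_xElt]
  · rw [Equiv.swap_apply_left]
  · rw [Equiv.swap_apply_right]
  · rw [Equiv.swap_apply_of_ne_of_ne h₃ h₂]
  · rw [Equiv.swap_apply_of_ne_of_ne h₁.symm h₃.symm]
  · rw [Equiv.swap_apply_left]
  · rw [Equiv.swap_apply_right]

theorem foldr_demazureD [NeZero n] (hn : 2 ≤ n) (ω : List (ZMod n)) (f : LambdaHat n) :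
    ω.foldr demazureD f = (ω.map (demazureEnd hn)).prod f := by
  induction ω with
  | nil => rfl
  | cons j ω ih =>
    rw [List.foldr_cons, ih, List.map_cons, List.prod_cons, AddMonoid.End.coe_mul,
      Function.comp_apply, demazureEnd_apply]

theorem foldr_demazureT [NeZero n] (hn : 2 ≤ n) (ω : List (ZMod n)) (f : LambdaHat n) :
    ω.foldr demazureT f = (ω.map fun j => demazureEnd hn j - 1).prod f := by
  induction ω with
  | nil => rfl
  | cons j ω ih =>
    rw [List.foldr_cons, ih, List.map_cons, List.prod_cons, AddMonoid.End.coe_mul,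
      Function.comp_apply, demazureEnd_sub_one_apply]

theorem foldr_demazureD_eq_of_isReduced [NeZero n] (hn : 3 ≤ n) {ω ω' : List (ZMod n)}
    (hω : (affineSystem n).IsReduced ω) (hω' : (affineSystem n).IsReduced ω')
    (h : (affineSystem n).wordProd ω = (affineSystem n).wordProd ω') (f : LambdaHat n) :
    ω.foldr demazureD f = ω'.foldr demazureD f := by
  rw [foldr_demazureD (by omega), foldr_demazureD (by omega),
    prod_map_eq_of_isReduced_affineSystem hn (fun _ _ => commute_demazureEnd hn)
      (demazureEnd_braid hn) hω hω' h]

theorem foldr_demazureT_eq_of_isReduced [NeZero n] (hn : 3 ≤ n) {ω ω' : List (ZMod n)}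
    (hω : (affineSystem n).IsReduced ω) (hω' : (affineSystem n).IsReduced ω')
    (h : (affineSystem n).wordProd ω = (affineSystem n).wordProd ω') (f : LambdaHat n) :
    ω.foldr demazureT f = ω'.foldr demazureT f := by
  have hn2 : 2 ≤ n := by omega
  rw [foldr_demazureT hn2, foldr_demazureT hn2]
  exact DFunLike.congr_fun (prod_map_eq_of_isReduced_affineSystem
    (f := fun j => demazureEnd hn2 j - 1) hn
    (fun _ _ hjk hk hj => commute_sub_one (R := AddMonoid.End (LambdaHat n))
      (commute_demazureEnd hn hjk hk hj))
    (fun j => braid_sub_one (R := AddMonoid.End (LambdaHat n)) (demazureEnd_mul_self hn2 j)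
      (demazureEnd_mul_self hn2 (j + 1)) (demazureEnd_braid hn j)) hω hω' h) f

theorem isReduced_reducedWord (x : AffineWeyl n) : (affineSystem n).IsReduced (reducedWord x) :=
  ((affineSystem n).exists_isReduced x).choose_spec.1

theorem wordProd_reducedWord (x : AffineWeyl n) : (affineSystem n).wordProd (reducedWord x) = x :=
  ((affineSystem n).exists_isReduced x).choose_spec.2.symm

theorem reducedWord_wordProd_of_length_le_one (hn : 2 ≤ n) {ω : List (ZMod n)}
    (hω : (affineSystem n).IsReduced ω) (hl : ω.length ≤ 1) :
    reducedWord ((affineSystem n).wordProd ω) = ω := by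
  have hlen : (reducedWord ((affineSystem n).wordProd ω)).length = ω.length := by
    rw [← hω.eq, ← (isReduced_reducedWord _).eq, wordProd_reducedWord]
  rcases Nat.le_one_iff_eq_zero_or_eq_one.1 hl with h0 | h1
  · rw [List.eq_nil_of_length_eq_zero h0] at hlen ⊢
    exact List.eq_nil_of_length_eq_zero hlen
  · obtain ⟨j, rfl⟩ := List.length_eq_one_iff.1 h1
    obtain ⟨k, hk⟩ := List.length_eq_one_iff.1 hlen
    have hprod := wordProd_reducedWord ((affineSystem n).wordProd [j])
    rw [hk, wordProd_singleton, wordProd_singleton] at hprod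
    rw [hk, affineSystem_simple_injective hn hprod]

-- For `n = 2` the group is an infinite dihedral group, and only words of length at most one occur.
theorem opD_wordProd [NeZero n] (hn : 2 ≤ n) {ω : List (ZMod n)}
    (hω : (affineSystem n).IsReduced ω) (hl : 3 ≤ n ∨ ω.length ≤ 1) (f : LambdaHat n) :
    opD ((affineSystem n).wordProd ω) f = ω.foldr demazureD f := by
  rcases hl with hn3 | hl
  · exact foldr_demazureD_eq_of_isReduced hn3 (isReduced_reducedWord _) hω
      (wordProd_reducedWord _) f
  · rw [opD, reducedWord_wordProd_of_length_le_one hn hω hl]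

theorem opT_wordProd [NeZero n] (hn : 2 ≤ n) {ω : List (ZMod n)}
    (hω : (affineSystem n).IsReduced ω) (hl : 3 ≤ n ∨ ω.length ≤ 1) (f : LambdaHat n) :
    opT ((affineSystem n).wordProd ω) f = ω.foldr demazureT f := by
  rcases hl with hn3 | hl
  · exact foldr_demazureT_eq_of_isReduced hn3 (isReduced_reducedWord _) hω
      (wordProd_reducedWord _) f
  · rw [opT, reducedWord_wordProd_of_length_le_one hn hω hl]

theorem three_le_or_length_rectWord_le_one (hn : 2 ≤ n) {i : ℕ} (hi : 1 ≤ i) (hin : i ≤ n) :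
    3 ≤ n ∨ (rectWord n i (n - i)).length ≤ 1 := by
  rw [length_rectWord]
  by_contra! h
  obtain rfl : n = 2 := by omega
  interval_cases i <;> omega

theorem kSchurClosedPart_kRect [NeZero n] (hn : 2 ≤ n) {i : ℕ} (hi : 1 ≤ i) (hin : i ≤ n) :
    kSchurClosedPart (kRect n i) = (rectWord n i (n - i)).foldr demazureD 1 := by
  rw [kSchurClosedPart, kSchurClosed, partElt, residueWord_kRect hi]
  exact opD_wordProd hn (isReduced_rectWord hn hi (Nat.add_sub_cancel' hin))
    (three_le_or_length_rectWord_le_one hn hi hin) 1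

theorem kSchurPart_kRect [NeZero n] (hn : 2 ≤ n) {i : ℕ} (hi : 1 ≤ i) (hin : i ≤ n) :
    kSchurPart (kRect n i) = (rectWord n i (n - i)).foldr demazureT 1 := by
  rw [kSchurPart, kSchur, partElt, residueWord_kRect hi]
  exact opT_wordProd hn (isReduced_rectWord hn hi (Nat.add_sub_cancel' hin))
    (three_le_or_length_rectWord_le_one hn hi hin) 1

theorem rectWord_suffix (i m k : ℕ) : rectWord n i m <:+ rectWord n i (m + k) := by
  induction k with
  | zero => exact List.suffix_rfl
  | succ k ih =>
    rw [← add_assoc, rectWord_succ]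
    exact ih.trans (List.suffix_append _ _)

theorem isReduced_rowWord_zero (hn : 2 ≤ n) {l : ℕ} (hl : l < n) :
    (affineSystem n).IsReduced (rowWord n 0 l) := by
  rcases Nat.eq_zero_or_pos l with rfl | hl0
  · simp [CoxeterSystem.IsReduced, rowWord]
  · have hred := isReduced_rectWord hn hl0 (Nat.add_sub_cancel' hl.le)
    obtain ⟨ω, hω⟩ := rectWord_suffix (n := n) l 1 (n - l - 1)
    rw [show 1 + (n - l - 1) = n - l by omega, show rectWord n l 1 = rowWord n 0 l by
      rw [← zero_add 1, rectWord_succ]; simp [rectWord]] at hω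
    rw [← hω] at hred
    simpa using hred.drop ω.length

theorem kSchur_rho [NeZero n] (hn : 2 ≤ n) {l : ℕ} (hl : l < n) :
    kSchur (rho n l) = (rowWord n 0 l).foldr demazureT 1 := by
  have hword : ((List.range l).reverse.map fun t => (t : ZMod n)) = rowWord n 0 l := by
    simp [rowWord, res, ← List.map_eq_flatMap]
  rw [kSchur, rho, hword]
  refine opT_wordProd hn (isReduced_rowWord_zero hn hl) ?_ 1
  rw [rowWord, List.length_map, List.length_reverse, List.length_range]
  omega

end DemazureOperators

open Finset

section ZeroHecke

variable {A B : Type*} {d : ℕ → B → B} {e : ℕ → A → A}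

/-- The composite `d (a + k - 1) ∘ ⋯ ∘ d (a + 1) ∘ d a`, by which a row of length `k` of a rectangle
acts. -/
def heckeChain (d : ℕ → B → B) (a : ℕ) : ℕ → B → B
  | 0 => id
  | k + 1 => d (a + k) ∘ heckeChain d a k

/-- The composite of `t` chains of length `k`, starting at `m`, `m - 1`, …, by which a rectangle
with `t` rows of length `k` acts. -/
def heckeRect (d : ℕ → B → B) (m k : ℕ) : ℕ → B → B
  | 0 => id
  | t + 1 => heckeChain d (m - t) k ∘ heckeRect d m k t

theorem heckeChain_semiconj {J : B → A} {a k : ℕ}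
    (h : ∀ p, a ≤ p → p < a + k → Function.Semiconj J (d p) (e p)) :
    Function.Semiconj J (heckeChain d a k) (heckeChain e a k) := by
  induction k with
  | zero => exact Function.Semiconj.id_right
  | succ k ih =>
    exact (h _ (by omega) (by omega)).comp_right (ih fun p h₁ h₂ => h p h₁ (by omega))

theorem heckeRect_semiconj {J : B → A} {m k t : ℕ} (ht : t ≤ m)
    (h : ∀ p, m - t < p → p < m + k → Function.Semiconj J (d p) (e p)) :
    Function.Semiconj J (heckeRect d m k t) (heckeRect e m k t) := by
  induction t with
  | zero => exact Function.Semiconj.id_right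
  | succ t ih =>
    exact (heckeChain_semiconj fun p h₁ h₂ => h p (by omega) (by omega)).comp_right
      (ih (by omega) fun p h₁ h₂ => h p (by omega) h₂)

theorem heckeChain_id (a k : ℕ) : heckeChain (fun _ => (id : A → A)) a k = id := by
  induction k with
  | zero => rfl
  | succ k ih => rw [heckeChain, ih, Function.comp_id]

theorem heckeRect_id (m k t : ℕ) : heckeRect (fun _ => (id : A → A)) m k t = id := by
  induction t with
  | zero => rfl
  | succ t ih => rw [heckeRect, ih, heckeChain_id, Function.comp_id]

theorem apply_heckeRect_of_invariant {J : B → A} {m k t : ℕ} (ht : t ≤ m)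
    (h : ∀ p, m - t < p → p < m + k → ∀ f, J (d p f) = J f) (f : B) :
    J (heckeRect d m k t f) = J f := by
  rw [heckeRect_semiconj (e := fun _ => id) ht h f, heckeRect_id, id]

/-- Idempotent operators `d 1, …, d (n - 1)` satisfying the braid relations of type `A_{n-1}`, that
is, an action of the `0`-Hecke monoid of the symmetric group. -/
structure IsZeroHecke (n : ℕ) (d : ℕ → B → B) : Prop where
  idem : ∀ p f, 1 ≤ p → p < n → d p (d p f) = d p f
  comm : ∀ p q, 1 ≤ p → p + 1 < q → q < n → Function.Commute (d p) (d q)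
  braid : ∀ p f, 1 ≤ p → p + 1 < n → d p (d (p + 1) (d p f)) = d (p + 1) (d p (d (p + 1) f))

namespace IsZeroHecke

variable {n : ℕ} (h : IsZeroHecke n d)
include h

theorem commute_heckeChain_of_lt {a k q : ℕ} (hq : 1 ≤ q) (hqa : q + 1 < a) (hn : a + k ≤ n) :
    Function.Commute (d q) (heckeChain d a k) :=
  heckeChain_semiconj fun p _ _ => h.comm q p hq (by omega) (by omega)

theorem commute_heckeChain_of_gt {a k q : ℕ} (ha : 1 ≤ a) (hq : a + k < q) (hqn : q < n) :
    Function.Commute (d q) (heckeChain d a k) :=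
  heckeChain_semiconj fun p _ _ => (h.comm p q (by omega) (by omega) hqn).symm

theorem apply_heckeChain {a k p : ℕ} (ha : 1 ≤ a) (hp : a ≤ p) (hpk : p + 1 < a + k)
    (hn : a + k ≤ n) (f : B) : d p (heckeChain d a k f) = heckeChain d a k (d (p + 1) f) := by
  induction k with
  | zero => omega
  | succ k ih =>
    by_cases hpe : p + 1 = a + k
    · obtain ⟨l, rfl⟩ : ∃ l, k = l + 1 := ⟨k - 1, by omega⟩
      obtain rfl : p = a + l := by omega
      simp only [heckeChain, Function.comp_apply]
      rw [← add_assoc, h.braid _ _ (by omega) (by omega),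
        (h.commute_heckeChain_of_gt ha (by omega) (by omega)).eq]
    · simp only [heckeChain, Function.comp_apply]
      rw [(h.comm p (a + k) (by omega) (by omega) (by omega)).eq, ih (by omega) (by omega)]

theorem apply_heckeChain_heckeChain {a k : ℕ} (ha : 1 ≤ a) (hn : a + k < n) (f : B) :
    d (a + k) (heckeChain d a k (heckeChain d (a + 1) k f)) =
      heckeChain d a k (heckeChain d (a + 1) k (d a f)) := by
  induction k with
  | zero => rfl
  | succ k ih =>
    have hcomm : Function.Commute (d (a + k + 1)) (heckeChain d a k) :=
      h.commute_heckeChain_of_gt ha (by omega) (by omega)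
    simp only [heckeChain, Function.comp_apply]
    rw [show a + 1 + k = a + k + 1 by omega, ← hcomm.eq, ← hcomm.eq, ← add_assoc,
      ← h.braid _ _ (by omega) (by omega), ih (by omega)]

-- For `t = m` the exceptional index is `0`, so the result is fixed by every generator.
theorem apply_heckeRect_eq_self {m k t : ℕ} (hmk : m + k = n) (hk : 1 ≤ k) (ht : t ≤ m) {f : B}
    (hf : ∀ p, 1 ≤ p → p < n → p ≠ m → d p f = f) {p : ℕ} (hp : 1 ≤ p) (hpn : p < n)
    (hpt : p ≠ m - t) : d p (heckeRect d m k t f) = heckeRect d m k t f := by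
  induction t using Nat.strong_induction_on generalizing p with
  | _ t ih =>
  rcases t with _ | t
  · exact hf p hp hpn hpt
  obtain ⟨a, ha⟩ : ∃ a, m - t = a := ⟨_, rfl⟩
  have hfix : ∀ {q}, 1 ≤ q → q < n → q ≠ a → d q (heckeRect d m k t f) = heckeRect d m k t f :=
    fun h₁ h₂ h₃ => ih t (by omega) (by omega) h₁ h₂ (by omega)
  rw [heckeRect, ha, Function.comp_apply]
  have hcases : p < a ∨ (a ≤ p ∧ p + 1 < a + k) ∨ p + 1 = a + k ∨ p = a + k ∨ a + k < p := by omega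
  rcases hcases with hlt | ⟨hle, hlt⟩ | heq | heq | hgt
  · rw [(h.commute_heckeChain_of_lt hp (by omega) (by omega)).eq, hfix hp hpn (by omega)]
  · rw [h.apply_heckeChain (by omega) hle hlt (by omega), hfix (by omega) (by omega) (by omega)]
  · obtain ⟨l, rfl⟩ : ∃ l, k = l + 1 := ⟨k - 1, by omega⟩
    obtain rfl : p = a + l := by omega
    rw [heckeChain, Function.comp_apply, h.idem _ _ hp hpn]
  · obtain ⟨u, rfl⟩ : ∃ u, t = u + 1 := ⟨t - 1, by omega⟩
    rw [heq, heckeRect, show m - u = a + 1 by omega, Function.comp_apply,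
      h.apply_heckeChain_heckeChain (by omega) (by omega),
      ih u (by omega) (by omega) (by omega) (by omega) (by omega)]
  · rw [(h.commute_heckeChain_of_gt (by omega) hgt hpn).eq, hfix hp hpn (by omega)]

end IsZeroHecke

variable [CommRing B] {d' : ℕ → B → B} {x : ℕ → B}

theorem mul_heckeChain {a k : ℕ}
    (h : ∀ p, a ≤ p → p < a + k → ∀ f, x (p + 1) * d' p f = d p (x p * f)) (f : B) :
    x (a + k) * heckeChain d' a k f = heckeChain d a k (x a * f) := by
  induction k with
  | zero => rfl
  | succ k ih =>
    rw [heckeChain, heckeChain, Function.comp_apply, Function.comp_apply,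
      ← ih fun p h₁ h₂ => h p h₁ (by omega), ← h _ (by omega) (by omega), add_assoc]

theorem apply_prod_mul_of_forall_apply_mul {ι : Type*} {D : B → B} {y : ι → B} {s : Finset ι}
    (h : ∀ q ∈ s, ∀ f, D (y q * f) = y q * D f) (f : B) :
    D ((∏ q ∈ s, y q) * f) = (∏ q ∈ s, y q) * D f := by
  classical
  induction s using Finset.induction_on with
  | empty => simp
  | insert q s hq ih =>
    rw [prod_insert hq, mul_assoc, h q (mem_insert_self q s),
      ih fun r hr => h r (mem_insert_of_mem hr), mul_assoc]

theorem prod_mul_heckeRect {m k t : ℕ} (ht : t ≤ m)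
    (h : ∀ p, 1 ≤ p → p < m + k → ∀ f, x (p + 1) * d' p f = d p (x p * f))
    (hx : ∀ p q, 1 ≤ p → p < m + k → 1 ≤ q → q ≤ m + k → q ≠ p → q ≠ p + 1 →
      ∀ f, d p (x q * f) = x q * d p f) (f : B) :
    (∏ s ∈ range t, x (m + k - s)) * heckeRect d' m k t f =
      heckeRect d m k t ((∏ s ∈ range t, x (m - s)) * f) := by
  induction t with
  | zero => simp [heckeRect]
  | succ t ih =>
    have hchain : ∀ g, heckeChain d (m - t) k ((∏ s ∈ range t, x (m + k - s)) * g) =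
        (∏ s ∈ range t, x (m + k - s)) * heckeChain d (m - t) k g := by
      refine fun g => (heckeChain_semiconj (J := (_ * ·)) (fun p _ _ g => ?_) g).symm
      refine (apply_prod_mul_of_forall_apply_mul (fun s hs => ?_) g).symm
      rw [mem_range] at hs
      exact hx _ _ (by omega) (by omega) (by omega) (by omega) (by omega) (by omega)
    have hrect : ∀ g, heckeRect d m k t (x (m - t) * g) = x (m - t) * heckeRect d m k t g := by
      refine fun g =>
        (heckeRect_semiconj (J := (x (m - t) * ·)) (by omega) (fun p _ _ g => ?_) g).symm
      exact (hx _ _ (by omega) (by omega) (by omega) (by omega) (by omega) (by omega) g).symm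
    calc (∏ s ∈ range (t + 1), x (m + k - s)) * heckeRect d' m k (t + 1) f
        = (∏ s ∈ range t, x (m + k - s)) *
            (x (m - t + k) * heckeChain d' (m - t) k (heckeRect d' m k t f)) := by
          rw [prod_range_succ, mul_assoc, heckeRect, Function.comp_apply,
            show m + k - t = m - t + k by omega]
      _ = heckeChain d (m - t) k
            (x (m - t) * ((∏ s ∈ range t, x (m + k - s)) * heckeRect d' m k t f)) := by
          rw [mul_heckeChain fun p _ _ => h p (by omega) (by omega), ← hchain, mul_left_comm]
      _ = heckeRect d m k (t + 1) ((∏ s ∈ range (t + 1), x (m - s)) * f) := by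
          rw [ih (by omega), ← hrect, heckeRect, Function.comp_apply, prod_range_succ,
            mul_comm _ (x (m - t)), mul_assoc]

end ZeroHecke

section RectangleOperators

theorem natCast_add_inj_of_lt {i p q : ℕ} (hp : p < n) (hq : q < n) :
    ((i + p : ℕ) : ZMod n) = ((i + q : ℕ) : ZMod n) ↔ p = q := by
  rw [Nat.cast_add, Nat.cast_add, add_right_inj, zmod_natCast_inj hp hq]

theorem natCast_add_inj_of_pos {i p q : ℕ} (hp : 1 ≤ p) (hpn : p ≤ n) (hq : 1 ≤ q) (hqn : q ≤ n) :
    ((i + p : ℕ) : ZMod n) = ((i + q : ℕ) : ZMod n) ↔ p = q := by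
  obtain ⟨p, rfl⟩ := Nat.exists_eq_add_of_le hp
  obtain ⟨q, rfl⟩ := Nat.exists_eq_add_of_le hq
  rw [← add_assoc, ← add_assoc, natCast_add_inj_of_lt (by omega) (by omega), add_right_inj]

theorem isZeroHecke_demazureD [NeZero n] (hn : 2 ≤ n) (i : ℕ) :
    IsZeroHecke n fun p => (demazureD ((i + p : ℕ) : ZMod n) : LambdaHat n → LambdaHat n) where
  idem p f _ _ := DFunLike.congr_fun (demazureEnd_mul_self hn ((i + p : ℕ) : ZMod n)) f
  comm p q h₁ h₂ h₃ f := by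
    refine DFunLike.congr_fun (commute_demazureEnd (by omega : 3 ≤ n)
      (j := ((i + p : ℕ) : ZMod n)) (k := ((i + q : ℕ) : ZMod n)) ?_ ?_ ?_).eq f
    all_goals
      simp only [← Nat.cast_add_one, add_assoc, ne_eq]
      rw [natCast_add_inj_of_pos (by omega) (by omega) (by omega) (by omega)]
      omega
  braid p f _ h₂ := by
    have := DFunLike.congr_fun
      (demazureEnd_braid (by omega : 3 ≤ n) ((i + p : ℕ) : ZMod n)) f
    rwa [← Nat.cast_add_one, add_assoc] at this

theorem foldr_rowWord {A : Type*} (d : ZMod n → A → A) {i m r : ℕ} (him : i + m = n) (hr : r ≤ m)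
    (c : ℕ) (f : A) :
    (rowWord n r c).foldr d f = heckeChain (fun p => d ((i + p : ℕ) : ZMod n)) (m - r) c f := by
  induction c with
  | zero => rfl
  | succ c ih =>
    have hres : res n r c = ((i + (m - r + c) : ℕ) : ZMod n) := by
      rw [res, sub_eq_iff_eq_add, ← Nat.cast_add, show i + (m - r + c) + r = c + n by omega]
      simp
    rw [rowWord_succ, List.foldr_cons, ih, heckeChain, Function.comp_apply, hres]

theorem foldr_rectWord {A : Type*} (d : ZMod n → A → A) {i m t : ℕ} (him : i + m = n) (ht : t ≤ m)
    (f : A) :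
    (rectWord n i t).foldr d f = heckeRect (fun p => d ((i + p : ℕ) : ZMod n)) m i t f := by
  induction t with
  | zero => rfl
  | succ t ih =>
    rw [rectWord_succ, List.foldr_append, ih (by omega), foldr_rowWord d him (by omega), heckeRect,
      Function.comp_apply]

theorem xElt_mul_demazureT [NeZero n] (hn : 2 ≤ n) (j : ZMod n) (f : LambdaHat n) :
    xElt (j + 1) * demazureT j f = demazureD j (xElt j * f) := by
  refine mul_left_cancel₀ (sub_ne_zero.2 (xElt_ne_xElt_add_one hn j)) ?_
  rw [mul_left_comm, xElt_sub_mul_demazureT, isDividedDifference_demazureD, semilinear_map_mul,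
    permHom_xElt, Equiv.swap_apply_left, simpleReflHom_apply]
  ring

theorem demazureD_xElt_mul [NeZero n] (hn : 2 ≤ n) {j k : ZMod n} (hj : k ≠ j) (hj' : k ≠ j + 1)
    (f : LambdaHat n) : demazureD j (xElt k * f) = xElt k * demazureD j f := by
  refine mul_left_cancel₀ (sub_ne_zero.2 (xElt_ne_xElt_add_one hn j)) ?_
  rw [mul_left_comm, isDividedDifference_demazureD, isDividedDifference_demazureD,
    semilinear_map_mul, permHom_xElt, Equiv.swap_apply_of_ne_of_ne hj hj']
  ring

theorem prod_xElt_mul_foldr_demazureT [NeZero n] (hn : 2 ≤ n) {i m : ℕ} (him : i + m = n)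
    (f : LambdaHat n) :
    (∏ s ∈ range m, xElt ((i : ZMod n) - (s : ZMod n))) * (rectWord n i m).foldr demazureT f =
      (rectWord n i m).foldr demazureD ((∏ s ∈ range m, xElt (-(s : ZMod n))) * f) := by
  have hleft : ∀ s ∈ range m,
      xElt ((i : ZMod n) - (s : ZMod n)) = xElt ((i + (m + i - s) : ℕ) : ZMod n) := by
    intro s hs
    rw [mem_range] at hs
    refine congrArg xElt (sub_eq_iff_eq_add.2 ?_)
    rw [← Nat.cast_add, show i + (m + i - s) + s = i + n by omega, Nat.cast_add, ZMod.natCast_self,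
      add_zero]
  have hright : ∀ s ∈ range m, xElt (-(s : ZMod n)) = xElt ((i + (m - s) : ℕ) : ZMod n) := by
    intro s hs
    rw [mem_range] at hs
    refine congrArg xElt (neg_eq_iff_add_eq_zero.2 ?_)
    rw [← Nat.cast_add, show s + (i + (m - s)) = n by omega, ZMod.natCast_self]
  rw [foldr_rectWord demazureT him le_rfl, foldr_rectWord demazureD him le_rfl,
    prod_congr rfl hleft, prod_congr rfl hright]
  refine prod_mul_heckeRect (x := fun p => xElt ((i + p : ℕ) : ZMod n)) le_rfl
    (fun p _ _ g => ?_) (fun p q _ _ _ _ hp hp' g => demazureD_xElt_mul hn ?_ ?_ g) f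
  · rw [← add_assoc, Nat.cast_add_one]
    exact xElt_mul_demazureT hn _ g
  · rwa [ne_eq, natCast_add_inj_of_pos (by omega) (by omega) (by omega) (by omega)]
  · rwa [← Nat.cast_add_one, add_assoc, ne_eq,
      natCast_add_inj_of_pos (by omega) (by omega) (by omega) (by omega)]

end RectangleOperators

section Alternants

theorem mul_prod_swap_pow {B : Type*} [CommMonoid B] (y : ℕ → B) {q N : ℕ} (hq : q + 1 < N) :
    y (q + 1) * ∏ k ∈ range N, y (Equiv.swap q (q + 1) k) ^ k = y q * ∏ k ∈ range N, y k ^ k := by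
  induction N, hq using Nat.le_induction with
  | base =>
    have hfix : ∀ k ∈ range q, y (Equiv.swap q (q + 1) k) ^ k = y k ^ k := fun k hk => by
      rw [mem_range] at hk
      rw [Equiv.swap_apply_of_ne_of_ne (by omega) (by omega)]
    rw [prod_range_succ, prod_range_succ, prod_range_succ, prod_range_succ, prod_congr rfl hfix,
      Equiv.swap_apply_left, Equiv.swap_apply_right]
    simp only [pow_succ]
    ac_rfl
  | succ N hN ih =>
    rw [prod_range_succ, prod_range_succ, ← mul_assoc, ih, mul_assoc,
      Equiv.swap_apply_of_ne_of_ne (by omega) (by omega)]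

/-- The monomial `∏_k (-e^{-a_{i+1+k}})^k`, whose alternant is a Vandermonde determinant. -/
noncomputable def staircase (n i : ℕ) : LambdaHat n :=
  ∏ k ∈ range n, (-xElt ((i + 1 + k : ℕ) : ZMod n)) ^ k

theorem swap_natCast_add {i q k : ℕ} (hq : q + 1 < n) (hk : k < n) :
    Equiv.swap ((i + q : ℕ) : ZMod n) (((i + q : ℕ) : ZMod n) + 1) ((i + k : ℕ) : ZMod n) =
      ((i + Equiv.swap q (q + 1) k : ℕ) : ZMod n) := by
  rw [← Nat.cast_add_one, add_assoc, Equiv.swap_apply_def, Equiv.swap_apply_def]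
  simp only [natCast_add_inj_of_lt hk (show q < n by omega), natCast_add_inj_of_lt hk hq]
  split_ifs <;> rfl

theorem xElt_mul_permHom_staircase (i : ℕ) {q : ℕ} (hq : q + 1 < n) :
    xElt (((i + 1 + q : ℕ) : ZMod n) + 1) *
        permHom (Equiv.swap ((i + 1 + q : ℕ) : ZMod n) (((i + 1 + q : ℕ) : ZMod n) + 1))
          (staircase n i) =
      xElt ((i + 1 + q : ℕ) : ZMod n) * staircase n i := by
  have hperm : ∀ k ∈ range n, (-xElt (Equiv.swap ((i + 1 + q : ℕ) : ZMod n)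
      (((i + 1 + q : ℕ) : ZMod n) + 1) ((i + 1 + k : ℕ) : ZMod n))) ^ k =
      (-xElt ((i + 1 + Equiv.swap q (q + 1) k : ℕ) : ZMod n)) ^ k := fun k hk => by
    rw [swap_natCast_add hq (mem_range.1 hk)]
  have hprod := mul_prod_swap_pow (fun k => -xElt ((i + 1 + k : ℕ) : ZMod n)) hq
  rw [staircase, map_prod]
  simp only [map_pow, map_neg, permHom_xElt]
  rw [prod_congr rfl hperm, ← Nat.cast_add_one, add_assoc (i + 1) q 1, ← neg_inj, ← neg_mul,
    ← neg_mul]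
  exact hprod

theorem neg_natCast_of_add_eq {i m : ℕ} (him : i + m = n) : -(m : ZMod n) = (i : ZMod n) := by
  rw [neg_eq_iff_add_eq_zero, ← Nat.cast_add, add_comm, him, ZMod.natCast_self]

theorem natCast_add_ne_neg_natCast {i m p : ℕ} (him : i + m = n) (hp : 1 ≤ p) (hpn : p < n) :
    ((i + p : ℕ) : ZMod n) ≠ -(m : ZMod n) := by
  rw [neg_natCast_of_add_eq him, ← add_zero i, add_assoc, zero_add, ne_eq,
    natCast_add_inj_of_lt hpn (by omega)]
  omega

variable [NeZero n]

/-- The antisymmetrization of an element of `Λ̂` over the permutations of the indices of the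
`a_j`. -/
noncomputable def alternant (u : LambdaHat n) : LambdaHat n :=
  ∑ w : Equiv.Perm (ZMod n), ((Equiv.Perm.sign w : ℤ) : LambdaHat n) * permHom w u

theorem alternant_add (u v : LambdaHat n) : alternant (u + v) = alternant u + alternant v := by
  simp only [alternant, map_add, mul_add, sum_add_distrib]

theorem alternant_mul_of_invariant {c : LambdaHat n} (hc : ∀ w, permHom w c = c)
    (u : LambdaHat n) : alternant (c * u) = c * alternant u := by
  simp only [alternant, map_mul, hc, mul_sum]
  exact sum_congr rfl fun w _ => mul_left_comm _ _ _

theorem alternant_eq_zero_of_permHom_swap {u : LambdaHat n} {j k : ZMod n} (hjk : j ≠ k)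
    (hu : permHom (Equiv.swap j k) u = u) : alternant u = 0 := by
  refine sum_involution (fun w _ => w * Equiv.swap j k) (fun w _ => ?_) (fun w _ _ h => ?_)
    (fun w _ => mem_univ _) (fun w _ => ?_)
  · rw [permHom_mul, hu, Equiv.Perm.sign_mul, Equiv.Perm.sign_swap hjk]
    push_cast
    ring
  · rw [mul_eq_left] at h
    exact hjk (Equiv.swap_eq_one_iff.1 h)
  · simp [mul_assoc]

theorem xElt_sub_mul_omegaProd_mul_demazureT {m : ℕ} (hm : m < n) {j : ZMod n}
    (hj : j ≠ -(m : ZMod n)) (f : LambdaHat n) :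
    (xElt j - xElt (j + 1)) * ((omegaProd n m : LambdaHat n) * demazureT j f) =
      xElt j * (permHom (Equiv.swap j (j + 1)) ((omegaProd n m : LambdaHat n) * f) -
        (omegaProd n m : LambdaHat n) * f) := by
  rw [mul_left_comm, xElt_sub_mul_demazureT, ← omegaProd_mul_simpleRefl hm hj]
  ring

theorem alternant_staircase_mul_demazureD (hn : 2 ≤ n) {i m q : ℕ} (hi : 1 ≤ i)
    (him : i + m = n) (hq : q + 1 < n) (f : LambdaHat n) :
    alternant (staircase n i * ((omegaProd n m : LambdaHat n) *
        demazureD ((i + 1 + q : ℕ) : ZMod n) f)) =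
      alternant (staircase n i * ((omegaProd n m : LambdaHat n) * f)) := by
  have hj : ((i + 1 + q : ℕ) : ZMod n) ≠ -(m : ZMod n) := by
    rw [add_assoc, add_comm 1 q]
    exact natCast_add_ne_neg_natCast him (by omega) hq
  have hstair := xElt_mul_permHom_staircase i hq
  generalize ((i + 1 + q : ℕ) : ZMod n) = j at hj hstair ⊢
  have hT := xElt_sub_mul_omegaProd_mul_demazureT (by omega) hj f
  rw [demazureD, mul_add, mul_add, alternant_add, add_eq_right]
  refine alternant_eq_zero_of_permHom_swap (zmod_add_one_ne hn j).symm ?_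
  set σ := Equiv.swap j (j + 1) with hσ
  set g := (omegaProd n m : LambdaHat n) * f
  set t := (omegaProd n m : LambdaHat n) * demazureT j f
  have hTσ : (xElt (j + 1) - xElt j) * permHom σ t = xElt (j + 1) * (g - permHom σ g) := by
    have := congrArg (permHom σ) hT
    rwa [map_mul (permHom σ) _ t, map_mul (permHom σ) (xElt j), map_sub, map_sub, permHom_xElt,
      permHom_xElt, ← permHom_mul, hσ, Equiv.swap_mul_self, permHom_one, Equiv.swap_apply_left,
      Equiv.swap_apply_right] at this
  rw [map_mul]
  refine mul_left_cancel₀ (sub_ne_zero.2 (xElt_ne_xElt_add_one hn j)) ?_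
  linear_combination -permHom σ (staircase n i) * hTσ - staircase n i * hT -
    (g - permHom σ g) * hstair

theorem alternant_foldr_demazureD (hn : 2 ≤ n) {i m : ℕ} (hi : 1 ≤ i) (him : i + m = n)
    (f : LambdaHat n) :
    alternant (staircase n i * ((omegaProd n m : LambdaHat n) *
        (rectWord n i m).foldr demazureD f)) =
      alternant (staircase n i * ((omegaProd n m : LambdaHat n) * f)) := by
  rw [foldr_rectWord demazureD him le_rfl]
  refine apply_heckeRect_of_invariant (J := fun f => alternant (staircase n i *
    ((omegaProd n m : LambdaHat n) * f))) le_rfl (fun p hp _ f => ?_) f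
  obtain ⟨q, rfl⟩ : ∃ q, p = 1 + q := Nat.exists_eq_add_of_le (by omega)
  rw [← add_assoc]
  exact alternant_staircase_mul_demazureD hn hi him (by omega) f

/-- The enumeration `i + 1, …, i + n` of `ℤ/n`. -/
noncomputable def indexEquiv (n i : ℕ) [NeZero n] : Fin n ≃ ZMod n :=
  Equiv.ofBijective (fun k => ((i + 1 + (k : ℕ) : ℕ) : ZMod n))
    ((Fintype.bijective_iff_injective_and_card _).2 ⟨fun k l h => Fin.ext
      ((natCast_add_inj_of_lt k.2 l.2).1 h), by rw [Fintype.card_fin, ZMod.card]⟩)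

theorem indexEquiv_apply (i : ℕ) (k : Fin n) :
    indexEquiv n i k = ((i + 1 + (k : ℕ) : ℕ) : ZMod n) := rfl

theorem permHom_eq_self_of_adjacent_swap (i : ℕ) {f : LambdaHat n}
    (hf : ∀ q, q + 1 < n → permHom (Equiv.swap ((i + 1 + q : ℕ) : ZMod n)
      (((i + 1 + q : ℕ) : ZMod n) + 1)) f = f) (w : Equiv.Perm (ZMod n)) : permHom w f = f := by
  obtain ⟨N, rfl⟩ := Nat.exists_eq_succ_of_ne_zero (NeZero.ne n)
  obtain ⟨v, rfl⟩ := (indexEquiv (N + 1) i).permCongr.surjective w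
  have hv : v ∈ Submonoid.closure
      (Set.range fun k : Fin N => Equiv.swap k.castSucc k.succ) := by
    rw [Equiv.Perm.mclosure_swap_castSucc_succ]
    exact Submonoid.mem_top v
  induction hv using Submonoid.closure_induction with
  | mem u hu =>
    obtain ⟨k, rfl⟩ := hu
    have hk := hf k (by omega)
    rw [← Nat.cast_add_one] at hk
    rw [Equiv.permCongr_def, Equiv.symm_trans_swap_trans, indexEquiv_apply, indexEquiv_apply]
    exact hk
  | one => rw [show (indexEquiv (N + 1) i).permCongr 1 = 1 by ext; simp, permHom_one]
  | mul u v _ _ hu hv => rw [Equiv.permCongr_mul, permHom_mul, hv, hu]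

theorem demazureD_foldr_rectWord_eq_self (hn : 2 ≤ n) {i m : ℕ} (hi : 1 ≤ i) (him : i + m = n)
    {f : LambdaHat n} (hf : ∀ j : ZMod n, j ≠ 0 → j ≠ -(m : ZMod n) → simpleRefl j f = f) {p : ℕ}
    (hp : 1 ≤ p) (hpn : p < n) :
    demazureD ((i + p : ℕ) : ZMod n) ((rectWord n i m).foldr demazureD f) =
      (rectWord n i m).foldr demazureD f := by
  rw [foldr_rectWord demazureD him le_rfl]
  refine (isZeroHecke_demazureD hn i).apply_heckeRect_eq_self (by omega) hi le_rfl
    (fun r hr hrn hrm => ?_) hp hpn (by omega)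
  refine (isDividedDifference_demazureD _).eq_self_of_map_eq_self (xElt_ne_xElt_add_one hn _)
    (hf _ ?_ (natCast_add_ne_neg_natCast him hr hrn))
  have hzero : ((i + m : ℕ) : ZMod n) = 0 := by rw [him, ZMod.natCast_self]
  rwa [← hzero, ne_eq, natCast_add_inj_of_lt hrn (by omega)]

theorem permHom_omegaProd_mul_foldr (hn : 2 ≤ n) {i m : ℕ} (hi : 1 ≤ i) (him : i + m = n)
    {f : LambdaHat n} (hf : ∀ j : ZMod n, j ≠ 0 → j ≠ -(m : ZMod n) → simpleRefl j f = f)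
    (w : Equiv.Perm (ZMod n)) :
    permHom w ((omegaProd n m : LambdaHat n) * (rectWord n i m).foldr demazureD f) =
      (omegaProd n m : LambdaHat n) * (rectWord n i m).foldr demazureD f := by
  refine permHom_eq_self_of_adjacent_swap i (fun q hq => ?_) w
  rw [add_assoc, add_comm 1 q]
  have hfix := demazureD_foldr_rectWord_eq_self hn hi him hf (p := q + 1) (by omega) hq
  rw [← omegaProd_mul_simpleRefl (by omega) (natCast_add_ne_neg_natCast him (by omega) hq), ← hfix,
    ← simpleReflHom_apply, (isDividedDifference_demazureD _).map_eq_self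
      (xElt_ne_xElt_add_one hn _) _ _ (simpleReflHom_involutive hn _)]
  all_goals simp [permHom_xElt]

/-- The matrix with entries `(-e^{-a_j})^k`, multiplied by `φ_j` in the first `m` columns; the rows
are indexed by `j = i + 1, …, i + n`. -/
noncomputable def bialternant (i m : ℕ) (φ : ZMod n → LambdaHat n) :
    Matrix (Fin n) (Fin n) (LambdaHat n) :=
  Matrix.of fun a k => (-xElt (indexEquiv n i a)) ^ (k : ℕ) *
    if (k : ℕ) < m then φ (indexEquiv n i a) else 1

theorem prod_neg_natCast_eq_prod_indexEquiv {i m : ℕ} (him : i + m = n) (φ : ZMod n → LambdaHat n) :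
    ∏ r ∈ range m, φ (-(r : ZMod n)) =
      ∏ k : Fin n, if (k : ℕ) < m then φ (indexEquiv n i k) else 1 := by
  have hfilter : (range n).filter (· < m) = range m := by
    ext k
    simp only [mem_filter, mem_range]
    omega
  refine Eq.trans ?_ (Fin.prod_univ_eq_prod_range
    (fun k => if k < m then φ ((i + 1 + k : ℕ) : ZMod n) else 1) n).symm
  rw [← prod_filter, ← prod_range_reflect, hfilter]
  refine prod_congr rfl fun r hr => congrArg φ ?_
  rw [mem_range] at hr
  rw [neg_eq_iff_add_eq_zero, ← Nat.cast_add, show m - 1 - r + (i + 1 + r) = n by omega,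
    ZMod.natCast_self]

theorem staircase_mul_prod_eq_prod_indexEquiv {i m : ℕ} (him : i + m = n)
    (φ : ZMod n → LambdaHat n) :
    staircase n i * ∏ r ∈ range m, φ (-(r : ZMod n)) =
      ∏ k : Fin n, ((-xElt (indexEquiv n i k)) ^ (k : ℕ) *
        if (k : ℕ) < m then φ (indexEquiv n i k) else 1) := by
  rw [prod_mul_distrib, staircase, ← Fin.prod_univ_eq_prod_range,
    prod_neg_natCast_eq_prod_indexEquiv him]
  rfl

theorem det_bialternant {i m : ℕ} (him : i + m = n) {φ : ZMod n → LambdaHat n}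
    (hφ : ∀ w j, permHom w (φ j) = φ (w j)) :
    (bialternant i m φ).det =
      alternant (staircase n i * ∏ r ∈ range m, φ (-(r : ZMod n))) := by
  rw [Matrix.det_apply', alternant, staircase_mul_prod_eq_prod_indexEquiv him,
    ← (indexEquiv n i).permCongr.sum_comp]
  refine sum_congr rfl fun σ _ => ?_
  rw [Equiv.Perm.sign_permCongr, map_prod]
  congr 1
  refine prod_congr rfl fun k _ => ?_
  rw [bialternant, Matrix.of_apply, map_mul, map_pow, map_neg, permHom_xElt,
    Equiv.permCongr_apply, Equiv.symm_apply_apply]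
  congr 1
  split_ifs
  · rw [hφ, Equiv.permCongr_apply, Equiv.symm_apply_apply]
  · rw [map_one]

theorem bialternant_one (i m : ℕ) :
    bialternant (n := n) i m (fun _ => 1) =
      Matrix.vandermonde fun a => -xElt (indexEquiv n i a) := by
  ext a k
  simp [bialternant, Matrix.vandermonde_apply]

theorem det_bialternant_one_ne_zero (hn : 2 ≤ n) (i m : ℕ) :
    (bialternant (n := n) i m fun _ => 1).det ≠ 0 := by
  have : Nontrivial (LambdaHat n) := ⟨_, _, xElt_ne_xElt_add_one hn 0⟩
  have : IsDomain (LambdaHat n) := NoZeroDivisors.to_isDomain _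
  rw [bialternant_one, Matrix.det_vandermonde_ne_zero_iff]
  exact neg_injective.comp ((xElt_injective hn).comp (indexEquiv n i).injective)

theorem omegaProd_mul_foldr_mul_det (hn : 2 ≤ n) {i m : ℕ} (hi : 1 ≤ i)
    (him : i + m = n) {ψ : ZMod n → LambdaHat n} (hψ : ∀ w j, permHom w (ψ j) = ψ (w j)) :
    (omegaProd n m : LambdaHat n) *
        (rectWord n i m).foldr demazureD (∏ r ∈ range m, ψ (-(r : ZMod n))) *
        (bialternant (n := n) i m fun _ => 1).det =
      (bialternant (n := n) i m fun j => (Omega (bpar j) : LambdaHat n) * ψ j).det := by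
  have hΩψ : ∀ w j, permHom w ((Omega (bpar j) : LambdaHat n) * ψ j) =
      (Omega (bpar (w j)) : LambdaHat n) * ψ (w j) := fun w j => by
    rw [map_mul, permHom_Omega, hψ]
  have hfix : ∀ j : ZMod n, j ≠ 0 → j ≠ -(m : ZMod n) →
      simpleRefl j (∏ r ∈ range m, ψ (-(r : ZMod n))) = ∏ r ∈ range m, ψ (-(r : ZMod n)) := by
    intro j hj0 hj
    rw [simpleRefl, if_neg hj0, ← permHom_apply]
    exact permHom_swap_prod_range hψ (by omega) hj hj0
  rw [det_bialternant him fun w j => map_one _, det_bialternant him hΩψ, prod_mul_distrib,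
    ← coe_omegaProd, ← alternant_foldr_demazureD hn hi him, mul_comm (staircase n i) (_ * _),
    alternant_mul_of_invariant (permHom_omegaProd_mul_foldr hn hi him hfix), prod_const_one,
    mul_one]

end Alternants

section OmegaMatrix

open Matrix

/-- The symmetric power series whose coefficient at every monomial of degree `d` is `c d`. -/
noncomputable def degSeries : (ℕ → RT n) →ₗ[RT n] LambdaHat n where
  toFun c := ⟨fun m => c m.degree, fun π => by
    ext1 m
    exact (coeff_renameEquiv π _ m).trans (congrArg c (Finsupp.degree_mapDomain _ _))⟩
  map_add' _ _ := rfl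
  map_smul' _ _ := rfl

theorem degSeries_pow (c : RT n) : degSeries (fun d => c ^ d) = (Omega c : LambdaHat n) := rfl

theorem permHom_degSeries (w : Equiv.Perm (ZMod n)) (c : ℕ → RT n) :
    permHom w (degSeries c) = degSeries fun d => permRT w (c d) := rfl

theorem algebraMap_mul_degSeries (r : RT n) (c : ℕ → RT n) :
    algebraMap (RT n) (LambdaHat n) r * degSeries c = degSeries (r • c) := by
  rw [← Algebra.smul_def, map_smul]

theorem degSeries_mul_algebraMap (c : ℕ → RT n) (r : RT n) :
    degSeries c * algebraMap (RT n) (LambdaHat n) r = degSeries (r • c) := by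
  rw [mul_comm, algebraMap_mul_degSeries]

/-- The matrix `Ω(1 - A|y)`, whose entry at a monomial of degree `d` is that of `(1 - A) ^ d`. -/
noncomputable def omegaMat (n : ℕ) : Matrix (Fin n) (Fin n) (LambdaHat n) :=
  Matrix.of fun a b => degSeries fun d => ((1 - matA n) ^ d) a b

/-- The matrix `A` over `Λ̂`. -/
noncomputable def matAHat (n : ℕ) : Matrix (Fin n) (Fin n) (LambdaHat n) :=
  (matA n).map (algebraMap (RT n) (LambdaHat n))

/-- The matrix `P` over `Λ̂`. -/
noncomputable def matPHat (n : ℕ) : Matrix (Fin n) (Fin n) (LambdaHat n) :=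
  (matP n).map (algebraMap (RT n) (LambdaHat n))

theorem commute_matAHat_omegaMat : Commute (matAHat n) (omegaMat n) := by
  ext1 a b
  have hA : ∀ d, matA n * (1 - matA n) ^ d = (1 - matA n) ^ d * matA n := fun d =>
    ((Commute.one_right (matA n)).sub_right (Commute.refl _)).pow_right d
  simp only [Matrix.mul_apply, matAHat, omegaMat, Matrix.map_apply, Matrix.of_apply,
    algebraMap_mul_degSeries, degSeries_mul_algebraMap, ← map_sum]
  refine congrArg degSeries (funext fun d => ?_)
  simp only [Finset.sum_apply, Pi.smul_apply, smul_eq_mul]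
  simpa only [Matrix.mul_apply, mul_comm (matA n _ b)] using congrFun₂ (hA d) a b

theorem matA_mulVec_apply {f : ℕ → RT n} (hf : f n = 0) (a : Fin n) :
    (matA n *ᵥ fun b => f b) a = exNeg n ((a : ℕ) + 1) * f a - f ((a : ℕ) + 1) := by
  have hentry : ∀ b : Fin n, matA n a b * f b =
      (if b = a then exNeg n ((a : ℕ) + 1) * f b else 0) -
        if (b : ℕ) = (a : ℕ) + 1 then f b else 0 := by
    intro b
    simp only [matA, Matrix.of_apply, Fin.ext_iff]
    split_ifs <;> first | omega | ring
  have hsuper : ∑ b : Fin n, (if (b : ℕ) = (a : ℕ) + 1 then f b else 0) = f ((a : ℕ) + 1) := by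
    rw [Fin.sum_univ_eq_sum_range (fun b => if b = (a : ℕ) + 1 then f b else 0), sum_ite_eq',
      ite_eq_left_iff, mem_range]
    intro h
    rw [show (a : ℕ) + 1 = n by omega, hf]
  rw [Matrix.mulVec, dotProduct, sum_congr rfl fun b _ => hentry b, sum_sub_distrib, hsuper,
    sum_ite_eq', if_pos (mem_univ a)]

/-- The complete homogeneous symmetric polynomial `h_{d-(q-p)}(b_p, …, b_q)`, given by the recursion
which the entries of the powers of `1 - A` satisfy. -/
noncomputable def powEntry (n : ℕ) : ℕ → ℕ → ℕ → RT n
  | 0, p, q => if p = q then 1 else 0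
  | d + 1, p, q => bpar (p : ZMod n) * powEntry n d p q + powEntry n d (p + 1) q

theorem powEntry_of_lt {d p q : ℕ} (h : q < p) : powEntry n d p q = 0 := by
  induction d generalizing p with
  | zero => rw [powEntry, if_neg (by omega)]
  | succ d ih => rw [powEntry, ih h, ih (by omega), mul_zero, add_zero]

theorem powEntry_self (d p : ℕ) : powEntry n d p p = bpar (p : ZMod n) ^ d := by
  induction d with
  | zero => rw [powEntry, if_pos rfl, pow_zero]
  | succ d ih => rw [powEntry, ih, powEntry_of_lt (Nat.lt_succ_self p), add_zero, pow_succ']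

theorem pow_one_sub_matA_apply (d : ℕ) (a b : Fin n) :
    ((1 - matA n) ^ d) a b = powEntry n d ((a : ℕ) + 1) ((b : ℕ) + 1) := by
  induction d generalizing a with
  | zero => simp [powEntry, Matrix.one_apply, Fin.ext_iff]
  | succ d ih =>
    have hA := matA_mulVec_apply (f := fun k => powEntry n d (k + 1) ((b : ℕ) + 1))
      (powEntry_of_lt (by omega)) a
    rw [Matrix.mulVec, dotProduct] at hA
    rw [pow_succ', sub_mul, one_mul, Matrix.sub_apply, Matrix.mul_apply]
    simp only [ih]
    rw [hA, powEntry, bpar, exNeg]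
    ring

theorem swap_natCast_add_one_apply_of_lt {p q : ℕ} (hpq : p < q) (hq : q + 1 < p + n) :
    Equiv.swap (q : ZMod n) ((q : ZMod n) + 1) (p : ZMod n) = p := by
  obtain ⟨e, rfl⟩ := Nat.exists_eq_add_of_le hpq.le
  rw [← add_zero p, add_right_comm, add_zero (p + e), swap_natCast_add (by omega) (by omega),
    Equiv.swap_apply_of_ne_of_ne (by omega) (by omega)]

theorem sub_mul_powEntry {d p q : ℕ} (hpq : p ≤ q) (hq : q + 1 < p + n) :
    (exNeg n q - exNeg n (q + 1)) * powEntry n d p (q + 1) =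
      permRT (Equiv.swap (q : ZMod n) ((q : ZMod n) + 1)) (powEntry n d p q) -
        powEntry n d p q := by
  induction d generalizing p with
  | zero =>
    simp only [powEntry]
    rw [if_neg (by omega)]
    split_ifs <;> simp
  | succ d ih =>
    rcases hpq.lt_or_eq with hlt | rfl
    · rw [powEntry, powEntry, map_add, map_mul, permRT_bpar,
        swap_natCast_add_one_apply_of_lt hlt hq]
      linear_combination bpar (p : ZMod n) * ih hpq hq + ih (p := p + 1) hlt (by omega)
    · have hp := ih le_rfl hq
      rw [powEntry_self, map_pow, permRT_bpar, Equiv.swap_apply_left] at hp ⊢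
      rw [powEntry, powEntry_self]
      simp only [exNeg, bpar, Nat.cast_add_one] at hp ⊢
      linear_combination (1 - ex (-wt (p : ZMod n))) * hp

/-- The signed divided difference of `Ω(1 - t|y)` at `e^{-a_p}, …, e^{-a_q}`. -/
noncomputable def omegaEntry (n p q : ℕ) : LambdaHat n := degSeries fun d => powEntry n d p q

theorem omegaMat_apply (a b : Fin n) :
    omegaMat n a b = omegaEntry n ((a : ℕ) + 1) ((b : ℕ) + 1) := by
  simp only [omegaMat, Matrix.of_apply, pow_one_sub_matA_apply, omegaEntry]

theorem omegaEntry_self (p : ℕ) : omegaEntry n p p = (Omega (bpar (p : ZMod n)) : LambdaHat n) := by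
  simp only [omegaEntry, powEntry_self, degSeries_pow]

theorem omegaEntry_of_lt {p q : ℕ} (h : q < p) : omegaEntry n p q = 0 := by
  simp only [omegaEntry, powEntry_of_lt h]
  exact map_zero degSeries

theorem sub_mul_omegaEntry {p q : ℕ} (hpq : p ≤ q) (hq : q + 1 < p + n) :
    (xElt (q : ZMod n) - xElt ((q : ZMod n) + 1)) * omegaEntry n p (q + 1) =
      permHom (Equiv.swap (q : ZMod n) ((q : ZMod n) + 1)) (omegaEntry n p q) -
        omegaEntry n p q := by
  rw [omegaEntry, omegaEntry, permHom_degSeries, ← map_sub, xElt, xElt, ← map_sub,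
    algebraMap_mul_degSeries]
  refine congrArg degSeries (funext fun d => ?_)
  rw [Pi.sub_apply, ← sub_mul_powEntry hpq hq, exNeg, exNeg, Nat.cast_add_one]
  rfl

end OmegaMatrix

section MatrixEntries

theorem zImage_add [NeZero n] (i l : ℕ) :
    zImage (n := n) i (i + l) =
      algebraMap (RT n) (LambdaHat n) (ex (∑ t ∈ Ico i (i + l), wt (t : ZMod n))) *
        permHom (Equiv.addRight (i : ZMod n))
          ((Omega (bpar (0 : ZMod n)) : LambdaHat n) * kSchur (rho n l)) := by
  have hzero : Equiv.addRight (i : ZMod n) 0 = i := zero_add _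
  rw [zImage, Algebra.smul_def, map_mul (permHom _), permHom_Omega, hzero, shiftPar,
    ← permHom_apply, Nat.add_sub_cancel_left]

theorem zImage_self [NeZero n] (hn : 2 ≤ n) (i : ℕ) :
    zImage (n := n) i i = (Omega (bpar (i : ZMod n)) : LambdaHat n) := by
  have hadd := zImage_add (n := n) i 0
  rw [add_zero] at hadd
  rw [hadd, kSchur_rho hn (by omega)]
  simp [rowWord, permHom_Omega, ex_zero]

theorem Omega_mul_kSchur_rho_succ [NeZero n] (hn : 2 ≤ n) {l : ℕ} (hl : l + 1 < n) :
    (xElt (l : ZMod n) - xElt ((l : ZMod n) + 1)) *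
        ((Omega (bpar (0 : ZMod n)) : LambdaHat n) * kSchur (rho n (l + 1))) =
      xElt (l : ZMod n) * (permHom (Equiv.swap (l : ZMod n) ((l : ZMod n) + 1))
          ((Omega (bpar (0 : ZMod n)) : LambdaHat n) * kSchur (rho n l)) -
        (Omega (bpar (0 : ZMod n)) : LambdaHat n) * kSchur (rho n l)) := by
  have hkSchur : kSchur (rho n (l + 1)) = demazureT (l : ZMod n) (kSchur (rho n l)) := by
    rw [kSchur_rho hn hl, kSchur_rho hn (by omega), rowWord_succ, List.foldr_cons, res,
      Nat.cast_zero, sub_zero]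
  have hΩ : (Omega (bpar (0 : ZMod n)) : LambdaHat n) = (omegaProd n 1 : LambdaHat n) := by
    simp [omegaProd]
  have hne : (l : ZMod n) ≠ -((1 : ℕ) : ZMod n) := by
    rw [ne_eq, eq_neg_iff_add_eq_zero, ← Nat.cast_add, ← Nat.cast_zero,
      zmod_natCast_inj hl (by omega)]
    omega
  rw [hkSchur, hΩ]
  exact xElt_sub_mul_omegaProd_mul_demazureT (by omega) hne _

theorem permHom_addRight_permHom_swap (i l : ℕ) (f : LambdaHat n) :
    permHom (Equiv.addRight (i : ZMod n))
        (permHom (Equiv.swap (l : ZMod n) ((l : ZMod n) + 1)) f) =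
      permHom (Equiv.swap ((i + l : ℕ) : ZMod n) (((i + l : ℕ) : ZMod n) + 1))
        (permHom (Equiv.addRight (i : ZMod n)) f) := by
  rw [← permHom_mul, ← permHom_mul, Equiv.mul_swap_eq_swap_mul, Equiv.coe_addRight,
    Nat.cast_add, add_comm (i : ZMod n), add_right_comm]

theorem permRT_swap_ex_sum_Ico {i j : ℕ} (hj : j + 1 < i + n) :
    permRT (Equiv.swap (j : ZMod n) ((j : ZMod n) + 1)) (ex (∑ t ∈ Ico i j, wt (t : ZMod n))) =
      ex (∑ t ∈ Ico i j, wt (t : ZMod n)) := by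
  rw [permRT_ex, map_sum]
  refine congrArg ex (sum_congr rfl fun t ht => ?_)
  rw [mem_Ico] at ht
  rw [permWeight_wt, swap_natCast_add_one_apply_of_lt ht.2 (by omega)]

theorem algebraMap_ex_wt_mul_xElt (j : ZMod n) :
    algebraMap (RT n) (LambdaHat n) (ex (wt j)) * xElt j = 1 := by
  rw [xElt, ← map_mul, ← ex_add, add_neg_cancel, ex_zero, map_one]

theorem sub_mul_zImage [NeZero n] (hn : 2 ≤ n) {i j : ℕ} (hij : i ≤ j) (hj : j + 1 < i + n) :
    (xElt (j : ZMod n) - xElt ((j : ZMod n) + 1)) * zImage i (j + 1) =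
      permHom (Equiv.swap (j : ZMod n) ((j : ZMod n) + 1)) (zImage i j) - zImage i j := by
  obtain ⟨l, rfl⟩ := Nat.exists_eq_add_of_le hij
  have hl : Equiv.addRight (i : ZMod n) l = ((i + l : ℕ) : ZMod n) := by
    rw [Equiv.coe_addRight, Nat.cast_add, add_comm]
  have hl' : Equiv.addRight (i : ZMod n) (l + 1) = ((i + l : ℕ) : ZMod n) + 1 := by
    rw [← hl, Equiv.coe_addRight, add_right_comm]
  have hshift := congrArg (permHom (Equiv.addRight (i : ZMod n)))
    (Omega_mul_kSchur_rho_succ hn (l := l) (by omega))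
  rw [map_mul _ (xElt (l : ZMod n) - _) _, map_mul _ (xElt (l : ZMod n)) _, map_sub, map_sub,
    permHom_addRight_permHom_swap, permHom_xElt, permHom_xElt, hl, hl'] at hshift
  have hunit := algebraMap_ex_wt_mul_xElt ((i + l : ℕ) : ZMod n)
  rw [add_assoc, zImage_add, zImage_add, map_mul (permHom (Equiv.swap _ _)), permHom_algebraMap,
    permRT_swap_ex_sum_Ico hj, ← add_assoc, sum_Ico_succ_top hij, ex_add, map_mul]
  set σ := permHom (Equiv.swap ((i + l : ℕ) : ZMod n) (((i + l : ℕ) : ZMod n) + 1))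
  set g := permHom (Equiv.addRight (i : ZMod n))
    ((Omega (bpar (0 : ZMod n)) : LambdaHat n) * kSchur (rho n l))
  set c := algebraMap (RT n) (LambdaHat n) (ex (∑ t ∈ Ico i (i + l), wt (t : ZMod n)))
  set e := algebraMap (RT n) (LambdaHat n) (ex (wt ((i + l : ℕ) : ZMod n)))
  linear_combination c * e * hshift + c * (σ g - g) * hunit

theorem zImage_eq_omegaEntry [NeZero n] (hn : 2 ≤ n) {i j : ℕ} (hij : i ≤ j) (hj : j < i + n) :
    zImage i j = omegaEntry n i j := by
  induction j, hij using Nat.le_induction with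
  | base => rw [zImage_self hn, omegaEntry_self]
  | succ j hij ih =>
    refine mul_left_cancel₀ (sub_ne_zero.2 (xElt_ne_xElt_add_one hn (j : ZMod n))) ?_
    rw [sub_mul_zImage hn hij hj, sub_mul_omegaEntry hij hj, ih (by omega)]

end MatrixEntries

section LeadingMinor

variable {R S : Type*} [CommRing R] [CommRing S]

/-- The matrix `X` with all rows but the first `m` replaced by those of the identity matrix. Its
determinant is the leading minor of `X` of order `m`. -/
def truncRows (m : ℕ) (X : Matrix (Fin n) (Fin n) R) : Matrix (Fin n) (Fin n) R :=
  Matrix.of fun a b => if (a : ℕ) < m then X a b else (1 : Matrix (Fin n) (Fin n) R) a b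

theorem truncRows_mul_apply (m : ℕ) (X V : Matrix (Fin n) (Fin n) R) (a b : Fin n) :
    (truncRows m X * V) a b = if (a : ℕ) < m then (X * V) a b else V a b := by
  rw [Matrix.mul_apply]
  simp only [truncRows, Matrix.of_apply]
  split_ifs
  · rw [Matrix.mul_apply]
  · rw [← Matrix.mul_apply, Matrix.one_mul]

theorem leadingMinor_eq_det_truncRows (X : Matrix (Fin n) (Fin n) R) {m : ℕ} (hm : m ≤ n) :
    leadingMinor X m hm = (truncRows m X).det := by
  rw [Matrix.twoBlockTriangular_det _ (fun a : Fin n => (a : ℕ) < m)]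
  · have hlower : (truncRows m X).toSquareBlockProp (fun a => ¬ (a : ℕ) < m) = 1 := by
      ext ⟨a, ha⟩ ⟨b, hb⟩
      simp [Matrix.toSquareBlockProp, truncRows, Matrix.one_apply, ha]
    let e : Fin m ≃ {a : Fin n // (a : ℕ) < m} :=
      { toFun := fun k => ⟨Fin.castLE hm k, k.2⟩
        invFun := fun a => ⟨a.1, a.2⟩
        left_inv := fun _ => rfl
        right_inv := fun _ => rfl }
    rw [hlower, Matrix.det_one, mul_one, leadingMinor, ← Matrix.det_submatrix_equiv_self e]
    congr 1
    ext k l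
    exact (if_pos k.2).symm
  · intro a ha b hb
    rw [truncRows, Matrix.of_apply, if_neg ha, Matrix.one_apply_ne]
    rintro rfl
    exact ha hb

theorem map_leadingMinor (φ : R →+* S) (X : Matrix (Fin n) (Fin n) R) {m : ℕ} (hm : m ≤ n) :
    φ (leadingMinor X m hm) = leadingMinor (X.map φ) m hm :=
  φ.map_det _

end LeadingMinor

section NewtonBasis

open Matrix

/-- The value at `t = e^{-a_j}` of the Newton polynomial `∏_{s ≤ k} (e^{-a_s} - t)`. -/
noncomputable def newton (n : ℕ) (j : ZMod n) (k : ℕ) : RT n :=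
  ∏ s ∈ range k, (exNeg n (s + 1) - ex (-wt j))

/-- The values at `t = e^{-a_j}` of the first `n` Newton polynomials, as a vector over `Λ̂`. -/
noncomputable def newtonVec (n : ℕ) (j : ZMod n) : Fin n → LambdaHat n :=
  fun k => algebraMap (RT n) (LambdaHat n) (newton n j k)

theorem newton_self [NeZero n] (j : ZMod n) : newton n j n = 0 := by
  refine prod_eq_zero (i := (j - 1).val) (mem_range.2 (ZMod.val_lt _)) ?_
  rw [exNeg, Nat.cast_add_one, ZMod.natCast_zmod_val, sub_add_cancel, sub_self]

theorem matA_mulVec_newton [NeZero n] (j : ZMod n) :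
    (matA n *ᵥ fun k => newton n j k) = ex (-wt j) • fun k : Fin n => newton n j k := by
  ext1 a
  rw [matA_mulVec_apply (newton_self j), Pi.smul_apply, smul_eq_mul, newton, newton,
    prod_range_succ]
  ring

theorem pow_one_sub_matA_mulVec_newton [NeZero n] (j : ZMod n) (d : ℕ) :
    (((1 - matA n) ^ d) *ᵥ fun k : Fin n => newton n j k) =
      bpar j ^ d • fun k : Fin n => newton n j k := by
  induction d with
  | zero => rw [pow_zero, pow_zero, one_mulVec, one_smul]
  | succ d ih =>
    rw [pow_succ, ← mulVec_mulVec, sub_mulVec, one_mulVec, matA_mulVec_newton, mulVec_sub,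
      mulVec_smul, ih, pow_succ, bpar, mul_sub, mul_one, sub_smul, smul_smul, mul_comm (ex _)]

theorem matAHat_mulVec_newtonVec [NeZero n] (j : ZMod n) :
    matAHat n *ᵥ newtonVec n j = xElt j • newtonVec n j := by
  ext1 a
  have hA := congrArg (algebraMap (RT n) (LambdaHat n)) (congrFun (matA_mulVec_newton j) a)
  rw [RingHom.map_mulVec, Pi.smul_apply, smul_eq_mul, map_mul] at hA
  exact hA

theorem omegaMat_mulVec_newtonVec [NeZero n] (j : ZMod n) :
    omegaMat n *ᵥ newtonVec n j = (Omega (bpar j) : LambdaHat n) • newtonVec n j := by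
  ext1 a
  simp only [mulVec, dotProduct, omegaMat, of_apply, newtonVec, Pi.smul_apply, smul_eq_mul,
    ← degSeries_pow, degSeries_mul_algebraMap, ← map_sum]
  refine congrArg degSeries (funext fun d => ?_)
  have hpow := congrFun (pow_one_sub_matA_mulVec_newton j d) a
  rw [mulVec, dotProduct, Pi.smul_apply, smul_eq_mul] at hpow
  simpa only [Finset.sum_apply, Pi.smul_apply, smul_eq_mul, mul_comm (newton n j _)] using hpow

theorem omegaMat_mul_matAHat_mulVec_newtonVec [NeZero n] (j : ZMod n) :
    (omegaMat n * matAHat n) *ᵥ newtonVec n j =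
      ((Omega (bpar j) : LambdaHat n) * xElt j) • newtonVec n j := by
  rw [← mulVec_mulVec, matAHat_mulVec_newtonVec, mulVec_smul, omegaMat_mulVec_newtonVec, smul_smul,
    mul_comm]

theorem newton_eq_sum_elemSymm (j : ZMod n) (k : ℕ) :
    newton n j k = ∑ b ∈ range (k + 1), elemSymm n k (k - b) * (-ex (-wt j)) ^ b := by
  have hVieta := congrArg (Polynomial.eval (-ex (-wt j)))
    (Multiset.prod_X_add_C_eq_sum_esymm ((Multiset.range k).map fun s => exNeg n (s + 1)))
  rw [Polynomial.eval_finsetSum, Polynomial.eval_multiset_prod, Multiset.map_map, Multiset.map_map,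
    Multiset.card_map, Multiset.card_range] at hVieta
  simp only [Polynomial.eval_mul, Polynomial.eval_C, Polynomial.eval_pow, Polynomial.eval_X,
    Function.comp_def, Polynomial.eval_add, neg_add_eq_sub] at hVieta
  rw [← sum_range_reflect]
  refine hVieta.trans (sum_congr rfl fun s hs => ?_)
  rw [mem_range] at hs
  rw [elemSymm, show k + 1 - 1 - s = k - s by omega, show k - (k - s) = s by omega]

theorem matP_mulVec_pow (j : ZMod n) :
    (matP n *ᵥ fun b => (-ex (-wt j)) ^ (b : ℕ)) = fun k : Fin n => newton n j k := by
  ext1 a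
  have hfilter : (range n).filter (fun b => b ≤ (a : ℕ)) = range ((a : ℕ) + 1) := by
    ext b
    simp only [mem_filter, mem_range]
    omega
  rw [newton_eq_sum_elemSymm, ← hfilter, sum_filter, ← Fin.sum_univ_eq_sum_range
    (fun b => if b ≤ (a : ℕ) then elemSymm n a ((a : ℕ) - b) * (-ex (-wt j)) ^ b else 0)]
  simp only [mulVec, dotProduct, matP, of_apply, ite_mul, zero_mul, Fin.le_def]

theorem matPHat_mulVec_pow (j : ZMod n) :
    (matPHat n *ᵥ fun b => (-xElt j) ^ (b : ℕ)) = newtonVec n j := by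
  ext1 a
  have hP := congrArg (algebraMap (RT n) (LambdaHat n)) (congrFun (matP_mulVec_pow j) a)
  rw [RingHom.map_mulVec] at hP
  simpa only [Function.comp_def, map_pow, map_neg, matPHat, xElt, newtonVec] using hP

theorem matPHat_eq_zero_of_lt {a b : Fin n} (h : a < b) : matPHat n a b = 0 := by
  rw [matPHat, map_apply, matP, of_apply, if_neg (not_le.2 h), map_zero]

theorem matPHat_self (a : Fin n) : matPHat n a a = 1 := by
  simp [matPHat, matP, elemSymm, Multiset.esymm]

theorem det_truncRows_matPHat (m : ℕ) : (truncRows m (matPHat n)).det = 1 := by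
  rw [det_of_isLowerTriangular]
  · refine prod_eq_one fun a _ => ?_
    simp only [truncRows, of_apply, matPHat_self, one_apply_eq, ite_self]
  · intro a b (hab : a < b)
    simp only [truncRows, of_apply, matPHat_eq_zero_of_lt hab, one_apply_ne hab.ne, ite_self]

theorem matPHat_mul_transpose_bialternant_apply [NeZero n] (i : ℕ) {m : ℕ}
    (φ : ZMod n → LambdaHat n) {a : Fin n} (ha : (a : ℕ) < m) (c : Fin n) :
    (matPHat n * (bialternant i m φ)ᵀ) a c =
      φ (indexEquiv n i c) * newtonVec n (indexEquiv n i c) a := by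
  rw [← matPHat_mulVec_pow, mul_apply, mulVec, dotProduct, mul_sum]
  refine sum_congr rfl fun b _ => ?_
  rw [transpose_apply, bialternant, of_apply]
  rcases lt_or_ge (b : ℕ) m with hb | hb
  · rw [if_pos hb]
    ring
  · rw [matPHat_eq_zero_of_lt (Fin.lt_def.2 (ha.trans_le hb)), zero_mul, zero_mul, mul_zero]

theorem truncRows_mul_transpose_bialternant [NeZero n] (i m : ℕ)
    {Y : Matrix (Fin n) (Fin n) (LambdaHat n)} {φ : ZMod n → LambdaHat n}
    (hY : ∀ j, Y *ᵥ newtonVec n j = φ j • newtonVec n j) :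
    truncRows m (Y * matPHat n) * (bialternant i m fun _ => 1)ᵀ =
      truncRows m (matPHat n) * (bialternant i m φ)ᵀ := by
  ext1 a c
  rw [truncRows_mul_apply, truncRows_mul_apply]
  split_ifs with ha
  · rw [matPHat_mul_transpose_bialternant_apply i φ ha]
    have hYc := congrFun (hY (indexEquiv n i c)) a
    rw [← matPHat_mulVec_pow, mulVec_mulVec, matPHat_mulVec_pow] at hYc
    rw [bialternant_one]
    exact hYc
  · simp only [transpose_apply, bialternant, of_apply, if_neg ha]

theorem leadingMinor_mul_det_bialternant [NeZero n] (i : ℕ) {m : ℕ} (hm : m ≤ n)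
    {Y : Matrix (Fin n) (Fin n) (LambdaHat n)} {φ : ZMod n → LambdaHat n}
    (hY : ∀ j, Y *ᵥ newtonVec n j = φ j • newtonVec n j) :
    leadingMinor (Y * matPHat n) m hm * (bialternant (n := n) i m fun _ => 1).det =
      (bialternant i m φ).det := by
  have hdet := congrArg det (truncRows_mul_transpose_bialternant i m hY)
  rwa [det_mul, det_mul, det_transpose, det_transpose, det_truncRows_matPHat, one_mul,
    ← leadingMinor_eq_det_truncRows _ hm] at hdet

end NewtonBasis

section CentralizerHom

/-- The images of the generators `z_{ij}` and `z_{ii}⁻¹` of `𝒪(𝒵̃)` under `Z ↦ Ω(1 - A|y)`. -/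
noncomputable def genImage (n : ℕ) : ZGen n → LambdaHat n :=
  Sum.elim (fun p => omegaMat n p.1.1 p.1.2)
    (fun a => (((Omega (bpar (((a : ℕ) + 1 : ℕ) : ZMod n)))⁻¹ : (LambdaHat n)ˣ) : LambdaHat n))

theorem map_aeval_freeZ : (freeZ n).map (MvPolynomial.aeval (genImage n)) = omegaMat n := by
  ext1 a b
  rw [Matrix.map_apply, freeZ, Matrix.of_apply]
  split_ifs with h
  · exact MvPolynomial.aeval_X _ _
  · rw [map_zero, omegaMat_apply, omegaEntry_of_lt (Nat.succ_lt_succ (not_le.1 h))]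

theorem map_aeval_commZ : (commZ n).map (MvPolynomial.aeval (genImage n)) = 0 := by
  have hA : ((matA n).map MvPolynomial.C).map (MvPolynomial.aeval (genImage n)) = matAHat n := by
    ext1 a b
    exact MvPolynomial.aeval_C _ _
  rw [commZ, Matrix.map_sub _ (map_sub _), Matrix.map_mul, Matrix.map_mul, hA, map_aeval_freeZ,
    commute_matAHat_omegaMat.eq, sub_self]

theorem aeval_genImage_eq_zero_of_mem_relZ {f : MvPolynomial (ZGen n) (RT n)} (hf : f ∈ relZ n) :
    MvPolynomial.aeval (genImage n) f = 0 := by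
  suffices relZ n ≤ RingHom.ker (MvPolynomial.aeval (R := RT n) (genImage n)) from this hf
  rw [relZ, Ideal.span_le]
  rintro _ (⟨p, rfl⟩ | ⟨a, rfl⟩)
  · exact congrFun₂ map_aeval_commZ p.1 p.2
  · have hdiag : MvPolynomial.aeval (genImage n) (freeZ n a a) = omegaMat n a a :=
      congrFun₂ map_aeval_freeZ a a
    rw [SetLike.mem_coe, RingHom.mem_ker, map_sub, map_mul, map_one, hdiag, MvPolynomial.aeval_X,
      omegaMat_apply, omegaEntry_self, genImage, Sum.elim_inr, Units.mul_inv, sub_self]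

/-- The homomorphism `β : 𝒪(𝒵̃) → Λ̂` sending `Z` to `Ω(1 - A|y)`. -/
noncomputable def centralizerHom (n : ℕ) : OZ n →ₐ[RT n] LambdaHat n :=
  Ideal.Quotient.liftₐ (relZ n) (MvPolynomial.aeval (genImage n))
    fun _ => aeval_genImage_eq_zero_of_mem_relZ

theorem map_centralizerHom_matZ : (matZ n).map (centralizerHom n) = omegaMat n :=
  map_aeval_freeZ

theorem centralizerHom_matZ_apply [NeZero n] (hn : 2 ≤ n) {i j : Fin n} (hij : i ≤ j) :
    centralizerHom n (matZ n i j) = zImage ((i : ℕ) + 1) ((j : ℕ) + 1) := by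
  rw [zImage_eq_omegaEntry hn (Nat.succ_le_succ hij) (by omega), ← omegaMat_apply,
    ← map_centralizerHom_matZ, Matrix.map_apply]

theorem map_centralizerHom_map_algebraMap (M : Matrix (Fin n) (Fin n) (RT n)) :
    (M.map (algebraMap (RT n) (OZ n))).map (centralizerHom n) =
      M.map (algebraMap (RT n) (LambdaHat n)) := by
  ext1 a b
  exact (centralizerHom n).commutes _

theorem centralizerHom_leadingMinor (X : Matrix (Fin n) (Fin n) (OZ n)) {m : ℕ} (hm : m ≤ n) :
    centralizerHom n (leadingMinor X m hm) = leadingMinor (X.map (centralizerHom n)) m hm :=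
  map_leadingMinor (centralizerHom n).toRingHom X hm

theorem centralizerHom_sigmaFun {m : ℕ} (hm : m ≤ n) :
    centralizerHom n (sigmaFun m hm) = leadingMinor (omegaMat n * matPHat n) m hm := by
  rw [sigmaFun, centralizerHom_leadingMinor, Matrix.map_mul, map_centralizerHom_matZ,
    map_centralizerHom_map_algebraMap, matPHat]

theorem centralizerHom_tauFun {m : ℕ} (hm : m ≤ n) :
    centralizerHom n (tauFun m hm) =
      leadingMinor (omegaMat n * matAHat n * matPHat n) m hm := by
  rw [tauFun, centralizerHom_leadingMinor, Matrix.map_mul, Matrix.map_mul, map_centralizerHom_matZ,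
    map_centralizerHom_map_algebraMap, map_centralizerHom_map_algebraMap, matPHat, matAHat]

end CentralizerHom

section Rectangles

variable [NeZero n] {i : ℕ}

theorem omegaProd_mul_kSchurClosedPart (hn : 2 ≤ n) (hi : 1 ≤ i) (hin : i ≤ n) :
    (omegaProd n (n - i) : LambdaHat n) * kSchurClosedPart (kRect n i) =
      centralizerHom n (sigmaFun (n - i) (Nat.sub_le n i)) := by
  refine mul_right_cancel₀ (det_bialternant_one_ne_zero hn i (n - i)) ?_
  have hdet := omegaProd_mul_foldr_mul_det hn hi (Nat.add_sub_cancel' hin) (ψ := fun _ => 1)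
    fun w _ => map_one (permHom w)
  simp only [prod_const_one, mul_one] at hdet
  rw [centralizerHom_sigmaFun, leadingMinor_mul_det_bialternant i _ omegaMat_mulVec_newtonVec,
    ← hdet, kSchurClosedPart_kRect hn hi hin]

theorem omegaProd_mul_kSchurPart (hn : 2 ≤ n) (hi : 1 ≤ i) (hin : i ≤ n) :
    (omegaProd n (n - i) : LambdaHat n) *
        ((∏ s ∈ range (n - i), xElt ((i : ZMod n) - (s : ZMod n))) * kSchurPart (kRect n i)) =
      centralizerHom n (tauFun (n - i) (Nat.sub_le n i)) := by
  have him : i + (n - i) = n := Nat.add_sub_cancel' hin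
  refine mul_right_cancel₀ (det_bialternant_one_ne_zero hn i (n - i)) ?_
  rw [centralizerHom_tauFun,
    leadingMinor_mul_det_bialternant i _ omegaMat_mul_matAHat_mulVec_newtonVec,
    ← omegaProd_mul_foldr_mul_det hn hi him permHom_xElt, kSchurPart_kRect hn hi hin,
    prod_xElt_mul_foldr_demazureT hn him, mul_one]

end Rectangles

theorem ex_sum {ι : Type*} (s : Finset ι) (μ : ι → Weight n) :
    ex (∑ k ∈ s, μ k) = ∏ k ∈ s, ex (μ k) := by
  classical
  induction s using Finset.induction_on with
  | empty => rw [sum_empty, prod_empty, ex_zero]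
  | insert a s ha ih => rw [sum_insert ha, prod_insert ha, ex_add, ih]

theorem ex_sum_wt_smul_prod_xElt {ι : Type*} (s : Finset ι) (j : ι → ZMod n) :
    ex (∑ k ∈ s, wt (j k)) • ∏ k ∈ s, (xElt (j k) : LambdaHat n) = 1 := by
  rw [Algebra.smul_def, ex_sum, map_prod, ← prod_mul_distrib]
  exact prod_eq_one fun k _ => algebraMap_ex_wt_mul_xElt (j k)

end KkSchur

theorem mainTheorem6 (n : ℕ) [NeZero n] (hn : 2 ≤ n) :
    ∃ β : KkSchur.OZ n →ₐ[KkSchur.RT n] KkSchur.LambdaHat n,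
      (∀ i j : Fin n, i ≤ j →
        β (KkSchur.matZ n i j) = KkSchur.zImage ((i : ℕ) + 1) ((j : ℕ) + 1)) ∧
      ∀ i : ℕ, 1 ≤ i → i ≤ n →
        KkSchur.kSchurClosedPart (KkSchur.kRect n i) =
          β (KkSchur.sigmaFun (n - i) (Nat.sub_le n i)) *
            ((KkSchur.xi (KkSchur.kRect n i))⁻¹).val ∧
        KkSchur.kSchurPart (KkSchur.kRect n i) =
          KkSchur.ex (∑ s ∈ Finset.range (n - i), KkSchur.wt ((i : ZMod n) - (s : ZMod n))) •
            (β (KkSchur.tauFun (n - i) (Nat.sub_le n i)) *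
              ((KkSchur.xi (KkSchur.kRect n i))⁻¹).val) := by
  refine ⟨KkSchur.centralizerHom n, fun i j hij => KkSchur.centralizerHom_matZ_apply hn hij,
    fun i hi hin => ⟨?_, ?_⟩⟩
  · rw [KkSchur.xi_kRect hi, Units.eq_mul_inv_iff_mul_eq, mul_comm,
      KkSchur.omegaProd_mul_kSchurClosedPart hn hi hin]
  · rw [KkSchur.xi_kRect hi, ← KkSchur.omegaProd_mul_kSchurPart hn hi hin, mul_right_comm,
      Units.mul_inv, one_mul, ← smul_mul_assoc, KkSchur.ex_sum_wt_smul_prod_xElt, one_mul]
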